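/- **Setting.** Let $R$ and $K$ be commutative $\mathbb{Q}$-algebras, let $\psi_n : R\to R$ ($n\ge 1$) be ring endomorphisms with $\psi_1=\mathrm{id}$ and $\psi_m\psi_n=\psi_{mn}$ (Adams operations), and let $\pi : R\to K$ be a ring homomorphism. (Typically $R=K_0\otimes\mathbb{Q}$ for the Grothendieck ring of $\ell$-adic Galois representations and $\pi$ is the trace of Frobenius; for point counts over a finite field, $R=\mathbb{Q}^{\{1,2,\dots\}}$ with $\psi_m((a_k)_k)=(a_{mk})_k$, and $\pi$ is the first coordinate.) For a partition $\rho=(1^{\rho(1)},2^{\rho(2)},\dots)$ put $|\rho|=\sum_i i\rho(i)$, $z_\rho=\prod_i i^{\rho(i)}\rho(i)!$ and $p_\rho=\prod_i p_i^{\rho(i)}$. Let $N_{g,\rho}\in R$ be an arbitrary family indexed by integers $g\ge 0$ and partitions $\rho$ (the values on cycle type $\rho$ of the $\mathbb{S}_{|\rho|}$-equivariant Euler characteristics of a stable $\mathbb{S}$-module $\mathcal{V}$, for instance $N_{g,\rho}=\big(|\mathscr{M}^{\rho F^k}_{g,|\rho|/\overline{\mathbb{F}}}|\big)_{k\ge1}$),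 and let $$\mathrm{ch}_g=\sum_{n\ge\max\{0,3-2g\}}\ \sum_{\rho\vdash n}N_{g,\rho}\,\frac{p_\rho}{z_\rho}\in R[[p_1,p_2,\dots]] .$$ For $f\in R[[p_1,p_2,\dots]]$ let $\psi_n(f)$ be obtained by applying $\psi_n$ to the coefficients and replacing $p_j$ by $p_{nj}$; if $g$ has no constant term, the plethysm is $f\circ g=f(\psi_1(g),\psi_2(g),\dots)$. Two series $f,g$ without constant term are plethystic inverses if $f\circ g=g\circ f=p_1$. Series over $R$ are regarded as series over $K$ through $\pi$ whenever this is needed. Put $\varepsilon_m=1$ for $m$ even and $\varepsilon_m=0$ for $m$ odd, and consider the formal expression $$\mathcal{K}(\mathbf{p},\mathbf{q},\hbar)=\sum_{k\ge1}\hbar^{-k}\Big\{-\frac{(q_k-p_k-\varepsilon_k\hbar^{k/2})^2}{2k}+\frac1k\sum_{g\ge0}\hbar^{kg}\,\psi_k(\mathrm{ch}_g)(\mathbf{q})\Big\},$$ differentiated term by term. A family $\bar{\mathbf q}=(\bar q_m)_{m\ge1}$ in $K[[\hbar,p_1,p_2,\dots]]$ is called substitutable if every $\bar q_m$ has nilpotent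 constant term and every monomial in $\hbar,p_1,p_2,\dots$ occurs in only finitely many $\bar q_m$; then it can be substituted for $\mathbf q$ in power series. Write $\bar q_m=\sum_{s\ge0}\bar c_{m,s}(\mathbf{p})\hbar^s$. **Proposition.** 1. The series $c_1=p_1-\partial\mathrm{ch}_0/\partial p_1\in R[[p_1,p_2,\dots]]$ has a unique plethystic inverse $\bar c_{1,0}$. 2. For substitutable $\bar{\mathbf q}$, the critical-point system $\frac{\partial\mathcal{K}}{\partial q_m}(\mathbf{p},\bar{\mathbf q},\hbar)=0$ ($m\ge1$) is equivalent to $$\bar q_m=p_m+\varepsilon_m\hbar^{m/2}+\sum_{k\mid m}\frac mk\sum_{g\ge0}\hbar^{kg+m-k}\,\frac{\partial\psi_k(\mathrm{ch}_g)}{\partial q_m}(\bar{\mathbf q})\qquad(m\ge1).\tag{$*$}$$ 3. Among the substitutable families with $$\bar q_m(\mathbf{p},\hbar)=\bar c_{m,0}(\mathbf{p})+O\big(\hbar^{(m+1-\varepsilon_m)/2}\big)\quad\text{for all } m\ge1$$ (where $\bar c_{m,0}$ is the constant term of $\bar q_m$ in $\hbar$, not prescribed in advance), there is exactly one that satisfies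 $(*)$. 4. For this solution $\bar c_{m,0}=\psi_m(\bar c_{1,0})$ for all $m\ge1$, where $\bar c_{1,0}$ is the plethystic inverse of $c_1$. For every even $m\ge2$ the series $1-\psi_m(\partial^2\mathrm{ch}_0/\partial p_1^2)$ is invertible, and $$\bar c_{m,m/2}=\frac{1+2\,\psi_{m/2}\!\left(\frac{\partial\mathrm{ch}_0}{\partial p_2}\right)}{1-\psi_m\!\left(\frac{\partial^2\mathrm{ch}_0}{\partial p_1^2}\right)}\circ\bar c_{1,0}.$$ -/

import Mathlib

open MvPowerSeries

noncomputable section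

namespace StableModule

/-! ### Symmetric functions in the power sums

The completed ring of symmetric functions over a commutative `ℚ`-algebra `R` is `R⟦p₁, p₂, …⟧`,
that is `MvPowerSeries ℕ+ R`. An exponent `ρ : ℕ+ →₀ ℕ` is the partition `(1^ρ(1), 2^ρ(2), …)`. -/

/-- The size `|ρ| = ∑ i ρ(i)` of the partition `ρ`. -/
def size (ρ : ℕ+ →₀ ℕ) : ℕ := ρ.sum fun i r => (i : ℕ) * r

/-- `z_ρ = ∏ i^ρ(i) ρ(i)!`. -/
def zee (ρ : ℕ+ →₀ ℕ) : ℕ := ρ.prod fun i r => (i : ℕ) ^ r * r.factorial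

section Plethysm

variable {R : Type*} [CommRing R]

/-- The Adams operation on `R⟦p₁, p₂, …⟧` extending the Adams operations `ψ` of `R`:
`f(p₁, p₂, …) ↦ f^ψₙ(pₙ, p₂ₙ, …)`, where `f^ψₙ` is `f` with `ψₙ` applied to its coefficients. -/
def adams (ψ : ℕ+ →* (R →+* R)) (n : ℕ+) (f : MvPowerSeries ℕ+ R) : MvPowerSeries ℕ+ R :=
  rename (mulLeftEmbedding n) (map (ψ n) f)

/-- The plethysm `f ∘ g = f(ψ₁ g, ψ₂ g, …)` (meaningful when `g` has no constant term). -/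
def plethysm (ψ : ℕ+ →* (R →+* R)) (f g : MvPowerSeries ℕ+ R) : MvPowerSeries ℕ+ R :=
  subst (fun n => adams ψ n g) f

/-- `f` and `g` are plethystic inverses: both have no constant term, and
`f ∘ g = p₁ = g ∘ f`. -/
structure IsPlethysticInverse (ψ : ℕ+ →* (R →+* R)) (f g : MvPowerSeries ℕ+ R) : Prop where
  constantCoeff_left : constantCoeff f = 0
  constantCoeff_right : constantCoeff g = 0
  left_comp : plethysm ψ f g = X 1
  right_comp : plethysm ψ g f = X 1

variable [Algebra ℚ R]

/-- `ch_g = ∑_{n ≥ max(0, 3 - 2g)} ∑_{ρ ⊢ n} N_{g,ρ} p_ρ / z_ρ`, where `N_{g,ρ}` is the value of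
the `𝕊ₙ`-equivariant Euler characteristic in genus `g` on permutations of cycle type `ρ`. -/
def ch (N : ℕ → (ℕ+ →₀ ℕ) → R) (g : ℕ) : MvPowerSeries ℕ+ R :=
  fun ρ => if 3 ≤ 2 * g + size ρ then ((zee ρ : ℚ)⁻¹) • N g ρ else 0

/-- `c₁ = p₁ - ∂ch₀/∂p₁`. -/
def c₁ (N : ℕ → (ℕ+ →₀ ℕ) → R) : MvPowerSeries ℕ+ R :=
  X 1 - pderiv R 1 (ch N 0)

end Plethysm

/-! ### Power series in `ħ` and the `p`'s

`K⟦ħ, p₁, p₂, …⟧` is `MvPowerSeries (Option ℕ+) K`, with `ħ = X none` and `pₘ = X (some m)`. -/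

section System

variable {R K : Type*} [CommRing R] [CommRing K]

/-- The coefficient of `ħ^s`, a power series in the `p`'s. -/
def hbarCoeff (s : ℕ) (F : MvPowerSeries (Option ℕ+) K) : MvPowerSeries ℕ+ K :=
  fun d => coeff (d.optionElim s) F

/-- The coefficientwise sum of a sequence of power series such that every monomial occurs in
finitely many of them. -/
def formalSum {σ : Type*} (F : ℕ → MvPowerSeries σ K) : MvPowerSeries σ K :=
  fun d => ∑ᶠ g, coeff d (F g)

/-- `εₘ = 1` for `m` even and `0` for `m` odd. -/
def eps (m : ℕ+) : ℕ := if Even (m : ℕ) then 1 else 0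

variable [Algebra ℚ R] [Algebra ℚ K]

/-- `ψₖ(ch_g)`, with coefficients in `K`: apply the Adams operation, then the trace
`π : R →+* K` to the coefficients. -/
def psiCh (ψ : ℕ+ →* (R →+* R)) (π : R →+* K) (N : ℕ → (ℕ+ →₀ ℕ) → R) (k : ℕ+) (g : ℕ) :
    MvPowerSeries ℕ+ K :=
  map π (adams ψ k (ch N g))

/-- The system
`q̄ₘ = pₘ + εₘ ħ^{m/2} + ∑_{k ∣ m} (m/k) ∑_{g ≥ 0} ħ^{kg+m-k} (∂ψₖ(ch_g)/∂qₘ)(q̄)`, `m ≥ 1`,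
for power series `q̄ₘ` in `ħ` and the `p`'s. The first condition says that the `q̄ₘ` can be
substituted for the variables of a power series. -/
structure IsFormalSolution (ψ : ℕ+ →* (R →+* R)) (π : R →+* K) (N : ℕ → (ℕ+ →₀ ℕ) → R)
    (qbar : ℕ+ → MvPowerSeries (Option ℕ+) K) : Prop where
  hasSubst : HasSubst qbar
  eqn : ∀ m : ℕ+, qbar m = X (some m) + (eps m : MvPowerSeries (Option ℕ+) K) *
      X none ^ ((m : ℕ) / 2) +
    ∑ k ∈ (Finset.Icc 1 m).filter (fun k : ℕ+ => (k : ℕ) ∣ (m : ℕ)),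
      ((m : ℕ) / (k : ℕ) : ℚ) • formalSum fun g =>
      X none ^ ((k : ℕ) * g + ((m : ℕ) - (k : ℕ))) *
        subst qbar (pderiv K m (psiCh ψ π N k g))

/-- The condition `q̄ₘ(p, ħ) = c̄_{m,0}(p) + O(ħ^{(m+1-εₘ)/2})` for all `m`, where `c̄_{m,0}` is
the constant term of `q̄ₘ` as a power series in `ħ`. -/
def HasForm (qbar : ℕ+ → MvPowerSeries (Option ℕ+) K) : Prop :=
  ∀ (m : ℕ+) (s : ℕ), 0 < s → s < ((m : ℕ) + 1 - eps m) / 2 → hbarCoeff s (qbar m) = 0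

/-! ### The function `𝒦`

Its variables are `ħ = X none`, `pₘ = X (some (.inl m))` and `qₘ = X (some (.inr m))`. -/

/-- The terms `𝒦ₖ` of the formal sum `𝒦 = ∑_{k ≥ 1} ħ^{-k} 𝒦ₖ`, namely
`𝒦ₖ = -(qₖ - pₖ - εₖ ħ^{k/2})² / 2k + (1/k) ∑_{g ≥ 0} ħ^{kg} ψₖ(ch_g)(q)`. -/
def kappa (ψ : ℕ+ →* (R →+* R)) (π : R →+* K) (N : ℕ → (ℕ+ →₀ ℕ) → R) (k : ℕ+) :
    MvPowerSeries (Option (ℕ+ ⊕ ℕ+)) K :=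
  -((2 * (k : ℕ) : ℚ)⁻¹ • (X (some (.inr k)) - X (some (.inl k)) -
      (eps k : MvPowerSeries (Option (ℕ+ ⊕ ℕ+)) K) * X none ^ ((k : ℕ) / 2)) ^ 2) +
    ((k : ℕ) : ℚ)⁻¹ • formalSum fun g => X none ^ ((k : ℕ) * g) *
      rename (Function.Embedding.inr.trans Function.Embedding.some) (psiCh ψ π N k g)

/-- `q̄` is a critical point of `𝒦`: `(∂𝒦/∂qₘ)(p, q̄, ħ) = 0` for all `m`. As `qₘ` occurs in `𝒦ₖ`
only if `k ∣ m`, the derivative `∂𝒦/∂qₘ` is the finite sum of the `ħ^{-k} ∂𝒦ₖ/∂qₘ` with `k ≤ m`,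
and the equation is written after multiplication by `ħ^m`. -/
def IsCriticalPoint (ψ : ℕ+ →* (R →+* R)) (π : R →+* K) (N : ℕ → (ℕ+ →₀ ℕ) → R)
    (qbar : ℕ+ → MvPowerSeries (Option ℕ+) K) : Prop :=
  ∀ m : ℕ+, ∑ k ∈ Finset.Icc 1 m, X none ^ ((m : ℕ) - (k : ℕ)) *
    subst (fun v : Option (ℕ+ ⊕ ℕ+) => v.elim (X none) (Sum.elim (fun j => X (some j)) qbar))
      (pderiv K (some (.inr m)) (kappa ψ π N k)) = 0

end System

end StableModule

end

open StableModule

/-! Give `ħ` weight 2 and `pₘ`, `qₘ` weight `m`. A monomial of the `(k, g)` term on the right of the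
system for `q̄ₘ` comes from some `p_ρ` in `ch_g` and has weight `m + k(2g + |ρ| - 2)`. Stability,
`2g + |ρ| ≥ 3`, makes this exceed `m`, so the right-hand side is a contraction for the weight
filtration. Its monomials with `ħ`-exponent below `m/2` have `k = m`, `g = 0`, contain no `ħ`, and
involve only variables `qᵢ` with `m ∣ i`. The asserted form is therefore preserved under iteration,
and the fixed point has it. `isContracting_interaction` records both facts and `exists_solvesSystem`
carries out the iteration.

Uniqueness (`SolvesSystem.unique`) must cover all substitutable families, for which no weight bound
is given. Every monomial of the `m`-th right-hand side contains `ħ`, or `qₘ²`, or some `qᵢ` with `i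
> m`. As a fixed coefficient is nonzero in only finitely many `q̄ₘ`, descending induction on `m`
shows that the nilpotent constant terms vanish, and then that two solutions agree in each total
degree.

The plethystic inverse comes from the same contraction principle, applied to `q = p₁ + G ∘ q`; a
right inverse has again the shape `p₁ - G'`, and associativity of plethysm makes it two-sided. At `ħ
= 0` the system becomes `qₘ = pₘ + ψₘ(∂ch₀/∂p₁)(q)`, which is also solved by `ψₘ(c̄)`; uniqueness
identifies the two (`hbarCoeff_zero_solution`). In order `ħ^{m/2}` only the source and the terms
`(k, g) = (m, 0)`, `(m/2, 0)` contribute, and a first order Taylor expansion (`hbarCoeff_subst`)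
gives a linear equation with an invertible coefficient (`hbarCoeff_solution`). -/

namespace MvPowerSeries

open Finsupp

/-! ### Weight filtrations and a contraction principle -/

section WeightIdeal

variable {σ τ S : Type*} [CommRing S]

variable (S) in
/-- The power series all of whose monomials have weight at least `n`. -/
def weightIdeal (w : τ → ℕ) (n : ℕ) : Ideal (MvPowerSeries τ S) where
  carrier := {f | ∀ d, weight w d < n → coeff d f = 0}
  add_mem' hf hg d hd := by rw [map_add, hf d hd, hg d hd, add_zero]
  zero_mem' _ _ := map_zero _
  smul_mem' c f hf d hd := by
    classical
    rw [smul_eq_mul, coeff_mul]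
    refine Finset.sum_eq_zero fun x hx => ?_
    rw [← Finset.HasAntidiagonal.mem_antidiagonal.mp hx, map_add] at hd
    rw [hf x.2 (by lia), mul_zero]

variable {w : τ → ℕ}

theorem weightIdeal_anti {m n : ℕ} (h : m ≤ n) : weightIdeal S w n ≤ weightIdeal S w m :=
  fun _ hf d hd => hf d (hd.trans_le h)

theorem mul_mem_weightIdeal {m n : ℕ} {f g : MvPowerSeries τ S} (hf : f ∈ weightIdeal S w m)
    (hg : g ∈ weightIdeal S w n) : f * g ∈ weightIdeal S w (m + n) := by
  classical
  intro d hd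
  rw [coeff_mul]
  refine Finset.sum_eq_zero fun x hx => ?_
  rw [← Finset.HasAntidiagonal.mem_antidiagonal.mp hx, map_add] at hd
  by_cases h : weight w x.1 < m
  · rw [hf _ h, zero_mul]
  · rw [hg _ (by lia), mul_zero]

theorem X_mem_weightIdeal (i : τ) : (X i : MvPowerSeries τ S) ∈ weightIdeal S w (w i) := by
  classical
  intro d hd
  rw [coeff_X, if_neg]
  rintro rfl
  simp [weight_single] at hd

theorem pow_mem_weightIdeal {m : ℕ} {f : MvPowerSeries τ S} (hf : f ∈ weightIdeal S w m) (r : ℕ) :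
    f ^ r ∈ weightIdeal S w (r * m) := by
  induction r with
  | zero => intro d hd; simp at hd
  | succ r ih => rw [pow_succ, add_one_mul]; exact mul_mem_weightIdeal ih hf

variable {v : σ → ℕ} {a b : σ → MvPowerSeries τ S}

theorem prod_pow_mem_weightIdeal (ha : ∀ i, a i ∈ weightIdeal S w (v i)) (e : σ →₀ ℕ) :
    (e.prod fun i r => a i ^ r) ∈ weightIdeal S w (weight v e) := by
  induction e using Finsupp.induction_linear with
  | zero => intro d hd; simp at hd
  | add e f he hf =>
    rw [prod_add_index' (by simp) (fun i => pow_add (a i)), map_add]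
    exact mul_mem_weightIdeal he hf
  | single i r =>
    rw [prod_single_index (by simp), weight_single]
    exact pow_mem_weightIdeal (ha i) r

/-- Telescoping `AB - A'B' = A(B - B') + (A - A')B'` lets the extra weight `n` of one factor's
difference survive in a product. -/
theorem prod_pow_sub_mem_weightIdeal {n : ℕ} (ha : ∀ i, a i ∈ weightIdeal S w (v i))
    (hb : ∀ i, b i ∈ weightIdeal S w (v i)) (hab : ∀ i, a i - b i ∈ weightIdeal S w (v i + n))
    (e : σ →₀ ℕ) :
    (e.prod fun i r => a i ^ r) - (e.prod fun i r => b i ^ r) ∈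
      weightIdeal S w (weight v e + n) := by
  have key : ∀ (A A' B B' : MvPowerSeries τ S) (k l : ℕ), A ∈ weightIdeal S w k →
      B' ∈ weightIdeal S w l → A - A' ∈ weightIdeal S w (k + n) →
      B - B' ∈ weightIdeal S w (l + n) → A * B - A' * B' ∈ weightIdeal S w (k + l + n) := by
    intro A A' B B' k l hA hB' hAA hBB
    rw [show A * B - A' * B' = A * (B - B') + (A - A') * B' by ring]
    refine add_mem ?_ ?_
    · rw [add_assoc]; exact mul_mem_weightIdeal hA hBB
    · rw [add_right_comm]; exact mul_mem_weightIdeal hAA hB'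
  induction e using Finsupp.induction_linear with
  | zero => simp
  | add e f he hf =>
    rw [prod_add_index' (by simp) (fun i => pow_add (a i)),
      prod_add_index' (by simp) (fun i => pow_add (b i)), map_add]
    exact key _ _ _ _ _ _ (prod_pow_mem_weightIdeal ha e) (prod_pow_mem_weightIdeal hb f) he hf
  | single i r =>
    rw [prod_single_index (by simp), prod_single_index (by simp), weight_single]
    induction r with
    | zero => simp
    | succ r ih =>
      rw [pow_succ, pow_succ, smul_eq_mul, add_one_mul]
      exact key _ _ _ _ _ _ (pow_mem_weightIdeal (ha i) r) (hb i) ih (hab i)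

theorem subst_mem_weightIdeal {N : ℕ} (ha : HasSubst a)
    (ha' : ∀ i, a i ∈ weightIdeal S w (v i)) {G : MvPowerSeries σ S}
    (hG : G ∈ weightIdeal S v N) : subst a G ∈ weightIdeal S w N := by
  intro d hd
  rw [coeff_subst ha]
  refine finsum_eq_zero_of_forall_eq_zero fun e => ?_
  by_cases he : weight v e < N
  · rw [hG e he, zero_smul]
  · rw [prod_pow_mem_weightIdeal ha' e d (by lia), smul_zero]

/-- This is the source of all contraction estimates: when `N` exceeds the expected weight of the
unknown by one, an agreement up to relative weight `n` improves to `n + 1`. -/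
theorem subst_sub_mem_weightIdeal {n N : ℕ} (ha : HasSubst a) (hb : HasSubst b)
    (ha' : ∀ i, a i ∈ weightIdeal S w (v i)) (hb' : ∀ i, b i ∈ weightIdeal S w (v i))
    (hab : ∀ i, a i - b i ∈ weightIdeal S w (v i + n)) {G : MvPowerSeries σ S}
    (hG : G ∈ weightIdeal S v N) : subst a G - subst b G ∈ weightIdeal S w (N + n) := by
  intro d hd
  rw [map_sub, coeff_subst ha, coeff_subst hb, sub_eq_zero]
  refine finsum_congr fun e => ?_
  by_cases he : weight v e < N
  · rw [hG e he, zero_smul, zero_smul]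
  · have := prod_pow_sub_mem_weightIdeal ha' hb' hab e d (by lia)
    rw [map_sub, sub_eq_zero] at this
    rw [this]

/-- A contraction of a set of families of power series, defined by the vanishing of certain
coefficients, has a fixed point. -/
theorem exists_fixedPoint {ι : Type*} (ρ : ι → (τ →₀ ℕ) → ℕ) (Z : ι → (τ →₀ ℕ) → Prop)
    (T : (ι → MvPowerSeries τ S) → ι → MvPowerSeries τ S)
    (hT : ∀ q, (∀ i d, Z i d → coeff d (q i) = 0) → ∀ i d, Z i d → coeff d (T q i) = 0)
    (hc : ∀ q q', (∀ i d, Z i d → coeff d (q i) = 0) → (∀ i d, Z i d → coeff d (q' i) = 0) →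
      ∀ n, (∀ i d, ρ i d < n → coeff d (q i) = coeff d (q' i)) →
      ∀ i d, ρ i d < n + 1 → coeff d (T q i) = coeff d (T q' i)) :
    ∃ q, (∀ i d, Z i d → coeff d (q i) = 0) ∧ T q = q := by
  let s : ℕ → ι → MvPowerSeries τ S := fun n => T^[n] 0
  have hs : ∀ n, s (n + 1) = T (s n) := fun n => Function.iterate_succ_apply' T n 0
  have hsZ : ∀ n i d, Z i d → coeff d (s n i) = 0 := by
    intro n
    induction n with
    | zero => intro i d _; exact map_zero _
    | succ n ih => rw [hs]; exact hT _ ih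
  have hstep : ∀ n i d, ρ i d < n → coeff d (s n i) = coeff d (s (n + 1) i) := by
    intro n
    induction n with
    | zero => intro i d h; lia
    | succ n ih =>
      rw [hs n, hs (n + 1)]
      exact hc _ _ (hsZ n) (hsZ (n + 1)) n ih
  have hstab : ∀ k n i d, ρ i d < n → coeff d (s n i) = coeff d (s (n + k) i) := by
    intro k
    induction k with
    | zero => intros; rfl
    | succ k ih => intro n i d h; rw [ih n i d h, hstep (n + k) i d (by lia), add_assoc]
  -- The limit of the iterates: a coefficient of measure `ρ i d` no longer changes from iterate `ρ i
  -- d + 1` on.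
  let q : ι → MvPowerSeries τ S := fun i d => coeff d (s (ρ i d + 1) i)
  have hq : ∀ i d, coeff d (q i) = coeff d (s (ρ i d + 1) i) := fun i d => rfl
  have hqZ : ∀ i d, Z i d → coeff d (q i) = 0 := fun i d h => by rw [hq, hsZ _ i d h]
  refine ⟨q, hqZ, funext fun i => ext fun d => ?_⟩
  rw [hc q (s (ρ i d)) hqZ (hsZ _) (ρ i d) ?_ i d (by lia), ← hs, hq]
  intro j e he
  rw [hq, hstab (ρ i d - (ρ j e + 1)) _ j e (by lia)]
  congr 3
  lia

end WeightIdeal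

/-! ### Derivatives, renaming and substitution, by density of polynomials -/

section Topology

open WithPiTopology

variable {σ τ S T : Type*} [CommRing S] [CommRing T]

/-- Two continuous functions of power series that agree on polynomials agree. -/
theorem eq_of_continuous_of_eq_on_polynomials {Y : Type*} [TopologicalSpace S]
    [TopologicalSpace Y] [T2Space Y] {F G : MvPowerSeries σ S → Y}
    (hF : Continuous F) (hG : Continuous G)
    (h : ∀ p : MvPolynomial σ S, F p = G p) : F = G :=
  DenseRange.equalizer denseRange_toMvPowerSeries hF hG (funext h)

theorem continuous_pderiv [TopologicalSpace S] [DiscreteTopology S] (i : σ) :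
    Continuous (pderiv S i : MvPowerSeries σ S → MvPowerSeries σ S) := by
  refine continuous_pi fun d => ?_
  change Continuous fun f => coeff d (pderiv S i f)
  simp only [coeff_pderiv]
  exact (continuous_of_discreteTopology (f := fun x : S => x * ((d i : S) + 1))).comp
    (continuous_coeff S _)

theorem continuous_rename [UniformSpace S] [DiscreteUniformity S] (e : σ ↪ τ) :
    Continuous (rename e : MvPowerSeries σ S → MvPowerSeries τ S) := by
  rw [show (rename e : MvPowerSeries σ S → MvPowerSeries τ S) = subst (X ∘ e) from
    funext fun p => rename_eq_subst e p]
  exact continuous_subst (HasSubst.X_comp e)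

theorem pderiv_rename (e : σ ↪ τ) (i : σ) (f : MvPowerSeries σ S) :
    pderiv S (e i) (rename e f) = rename e (pderiv S i f) := by
  let : UniformSpace S := ⊥
  refine congrFun (eq_of_continuous_of_eq_on_polynomials (F := fun f => pderiv S (e i) (rename e f))
    (G := fun f => rename e (pderiv S i f)) ((continuous_pderiv _).comp (continuous_rename e))
    ((continuous_rename e).comp (continuous_pderiv _)) fun p => ?_) f
  rw [rename_coe, pderiv_coe, MvPolynomial.pderiv_rename e.injective, pderiv_coe, rename_coe]

theorem pderiv_rename_of_notMem (e : σ ↪ τ) {j : τ} (hj : j ∉ Set.range e)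
    (f : MvPowerSeries σ S) : pderiv S j (rename e f) = 0 := by
  ext d
  rw [coeff_pderiv, coeff_rename_eq_zero, zero_mul, map_zero]
  rintro ⟨x, hx⟩
  rw [← embDomain_eq_mapDomain] at hx
  have := DFunLike.congr_fun hx j
  rw [embDomain_of_notMem_range _ _ _ hj] at this
  simp at this

theorem subst_rename {υ : Type*} (e : σ ↪ τ) {a : τ → MvPowerSeries υ S} (ha : HasSubst a)
    (f : MvPowerSeries σ S) : subst a (rename e f) = subst (a ∘ e) f := by
  rw [rename_eq_subst, subst_comp_subst_apply (HasSubst.X_comp e) ha]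
  congr 1
  funext i
  exact subst_X ha _

theorem rename_subst {υ : Type*} (e : τ ↪ υ) {a : σ → MvPowerSeries τ S} (ha : HasSubst a)
    (f : MvPowerSeries σ S) : rename e (subst a f) = subst (fun i => rename e (a i)) f := by
  rw [rename_eq_subst, subst_comp_subst_apply ha (HasSubst.X_comp e)]
  simp only [rename_eq_subst]

theorem HasSubst.comp_embedding {a : τ → MvPowerSeries σ S} {υ : Type*} (ha : HasSubst a)
    (e : υ ↪ τ) : HasSubst (a ∘ e) where
  const_coeff i := ha.const_coeff (e i)
  coeff_zero d := (ha.coeff_zero d).preimage e.injective.injOn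

theorem map_pderiv (φ : S →+* T) (i : σ) (f : MvPowerSeries σ S) :
    map φ (pderiv S i f) = pderiv T i (map φ f) := by
  ext d
  simp [coeff_pderiv]

end Topology

end MvPowerSeries

namespace MvPowerSeries

open Finsupp

/-! ### Setting variables to zero, and supports -/

section KillCompl

open WithPiTopology

variable {ρ σ τ S : Type*} [CommRing S]

theorem HasSubst.killCompl {a : ρ → MvPowerSeries τ S} (ha : HasSubst a) (e : σ ↪ τ) :
    HasSubst fun t => killCompl e (a t) where
  const_coeff t := by
    have : constantCoeff (MvPowerSeries.killCompl e (a t)) = constantCoeff (a t) := by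
      rw [← coeff_zero_eq_constantCoeff_apply, coeff_killCompl, embDomain_zero,
        coeff_zero_eq_constantCoeff_apply]
    rw [this]
    exact ha.const_coeff t
  coeff_zero d := by simpa only [coeff_killCompl] using ha.coeff_zero (embDomain e d)

/-- Written as a substitution, the operation of setting variables to zero can be composed with other
substitutions. -/
theorem killCompl_eq_subst (e : σ ↪ τ) (f : MvPowerSeries τ S) :
    killCompl e f = subst (fun t => killCompl e (X t : MvPowerSeries τ S)) f := by
  let : UniformSpace S := ⊥
  have hX := (HasSubst.X (σ := τ) (S := S)).killCompl e
  refine congrFun (eq_of_continuous_of_eq_on_polynomials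
    (F := (killCompl e : MvPowerSeries τ S → MvPowerSeries σ S))
    (G := subst fun t => killCompl e (X t : MvPowerSeries τ S))
    (continuous_pi fun d => continuous_coeff S (embDomain e d))
    (continuous_subst hX)
    fun p => ?_) f
  rw [subst_coe]
  refine DFunLike.congr_fun (f := ((killCompl e).comp (MvPolynomial.coeToMvPowerSeries.algHom S)))
    (g := MvPolynomial.aeval _) (MvPolynomial.algHom_ext fun t => ?_) p
  simp

theorem killCompl_subst (e : σ ↪ τ) {a : ρ → MvPowerSeries τ S} (ha : HasSubst a)
    (f : MvPowerSeries ρ S) : killCompl e (subst a f) = subst (fun s => killCompl e (a s)) f := by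
  rw [killCompl_eq_subst, subst_comp_subst_apply ha (HasSubst.X.killCompl e)]
  simp only [← killCompl_eq_subst]

end KillCompl

variable {τ S : Type*} [CommRing S]

theorem coeff_pderiv_ne_zero {i : τ} {f : MvPowerSeries τ S} {d : τ →₀ ℕ}
    (h : coeff d (pderiv S i f) ≠ 0) : coeff (d + single i 1) f ≠ 0 := by
  rw [coeff_pderiv] at h
  exact left_ne_zero_of_mul h

theorem exists_of_coeff_rename_ne_zero {σ : Type*} {e : σ ↪ τ} {f : MvPowerSeries σ S} {d : τ →₀ ℕ}
    (h : coeff d (rename e f) ≠ 0) : ∃ x, embDomain e x = d ∧ coeff x f ≠ 0 := by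
  obtain ⟨x, rfl⟩ : d ∈ Set.range (mapDomain e) := by
    contrapose! h
    exact coeff_rename_eq_zero e f h
  rw [← embDomain_eq_mapDomain] at h ⊢
  exact ⟨x, rfl, by rwa [coeff_embDomain_rename] at h⟩

/-- A monomial of weight `n` can occur only in the `q i` with `i ≤ n`, and the constant terms vanish
because `i ≥ 1`. -/
theorem hasSubst_of_mem_weightIdeal {w : τ → ℕ} {q : ℕ+ → MvPowerSeries τ S}
    (hq : ∀ i : ℕ+, q i ∈ weightIdeal S w i) : HasSubst q where
  const_coeff i := by
    rw [← coeff_zero_eq_constantCoeff_apply, hq i 0 (by simp)]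
    exact IsNilpotent.zero
  coeff_zero d := by
    refine ((Set.finite_Iic (weight w d)).preimage (f := PNat.val)
      PNat.coe_injective.injOn).subset fun i hi => ?_
    by_contra h
    exact hi (hq i d (by simpa using h))

end MvPowerSeries

namespace StableModule

open Finsupp

theorem weight_val_eq_size (ρ : ℕ+ →₀ ℕ) : weight PNat.val ρ = size ρ := by
  simp [size, weight_apply, mul_comm]

theorem size_add_single (ρ : ℕ+ →₀ ℕ) (m : ℕ+) : size (ρ + single m 1) = size ρ + m := by
  rw [← weight_val_eq_size, ← weight_val_eq_size, map_add, weight_single]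
  simp

theorem size_embDomain (n : ℕ+) (ρ : ℕ+ →₀ ℕ) :
    size (embDomain (mulLeftEmbedding n) ρ) = n * size ρ := by
  induction ρ using Finsupp.induction_linear with
  | zero => simp [size]
  | add f g hf hg =>
    rw [embDomain_eq_mapDomain] at hf hg ⊢
    rw [mapDomain_add, ← embDomain_eq_mapDomain, ← embDomain_eq_mapDomain,
      ← weight_val_eq_size, map_add, weight_val_eq_size, weight_val_eq_size,
      embDomain_eq_mapDomain, embDomain_eq_mapDomain, hf, hg,
      ← weight_val_eq_size (f + g), map_add, weight_val_eq_size, weight_val_eq_size, mul_add]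
  | single i r =>
    rw [embDomain_single, ← weight_val_eq_size, ← weight_val_eq_size, weight_single, weight_single]
    simp [mul_left_comm]

/-! ### Plethysm and plethystic inverses -/

section Plethysm

variable {R : Type*} [CommRing R] (ψ : ℕ+ →* (R →+* R))

/-- The Adams operation as a ring homomorphism. -/
noncomputable def adamsHom (n : ℕ+) : MvPowerSeries ℕ+ R →+* MvPowerSeries ℕ+ R :=
  (rename (R := R) (mulLeftEmbedding n)).toRingHom.comp (map (ψ n))

theorem adamsHom_apply (n : ℕ+) (f : MvPowerSeries ℕ+ R) : adamsHom ψ n f = adams ψ n f := rfl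

theorem adams_X (n i : ℕ+) : adams ψ n (X i) = X (n * i) := by
  simp [adams]

theorem adams_one_left (f : MvPowerSeries ℕ+ R) : adams ψ 1 f = f := by
  have h : (mulLeftEmbedding (1 : ℕ+) : ℕ+ → ℕ+) = id := funext fun i => by simp
  simp only [adams, map_one]
  ext d
  simp [h]

theorem adams_adams (m n : ℕ+) (f : MvPowerSeries ℕ+ R) :
    adams ψ m (adams ψ n f) = adams ψ (m * n) f := by
  have h : (mulLeftEmbedding (m * n) : ℕ+ → ℕ+) = mulLeftEmbedding m ∘ mulLeftEmbedding n :=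
    funext fun i => by simp [mul_assoc]
  simp only [adams, ← rename_map, rename_rename, map_mul]
  ext d
  rw [coeff_rename, coeff_rename]
  simp only [h]
  rfl

theorem adams_mem_weightIdeal (n : ℕ+) {k : ℕ} {f : MvPowerSeries ℕ+ R}
    (hf : f ∈ weightIdeal R PNat.val k) : adams ψ n f ∈ weightIdeal R PNat.val (n * k) := by
  intro d hd
  by_contra h
  obtain ⟨x, rfl, hx⟩ := exists_of_coeff_rename_ne_zero h
  rw [weight_val_eq_size, size_embDomain] at hd
  refine hx ?_
  rw [coeff_map, hf x ?_, map_zero]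
  rw [weight_val_eq_size]
  exact lt_of_mul_lt_mul_left' hd

theorem hasSubst_adams_of_mem {g : MvPowerSeries ℕ+ R} (hg : g ∈ weightIdeal R PNat.val 1) :
    HasSubst fun n => adams ψ n g :=
  hasSubst_of_mem_weightIdeal fun n => by simpa using adams_mem_weightIdeal ψ n hg

theorem mem_weightIdeal_one_iff {g : MvPowerSeries ℕ+ R} :
    g ∈ weightIdeal R PNat.val 1 ↔ constantCoeff g = 0 := by
  refine ⟨fun h => h 0 (by simp), fun h d hd => ?_⟩
  obtain rfl : d = 0 := by
    ext i
    simpa [Nat.lt_one_iff.mp hd] using le_weight PNat.val i.ne_zero d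
  exact h

/-- Rests on `ψₘψₙ = ψₘₙ`; it is the identity behind associativity of plethysm. -/
theorem adams_plethysm (m : ℕ+) {f g : MvPowerSeries ℕ+ R}
    (hg : g ∈ weightIdeal R PNat.val 1) :
    adams ψ m (plethysm ψ f g) = subst (fun n => adams ψ n g) (adams ψ m f) := by
  have hs := hasSubst_adams_of_mem ψ hg
  rw [plethysm, adams, map_subst hs, rename_subst _ (hs.map _), adams, subst_rename _ hs]
  congr 1
  funext n
  exact adams_adams ψ m n g

theorem plethysm_assoc {f g h : MvPowerSeries ℕ+ R} (hg : g ∈ weightIdeal R PNat.val 1)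
    (hh : h ∈ weightIdeal R PNat.val 1) :
    plethysm ψ f (plethysm ψ g h) = plethysm ψ (plethysm ψ f g) h := by
  have hs := hasSubst_adams_of_mem ψ hh
  conv_rhs => rw [plethysm, plethysm, subst_comp_subst_apply (hasSubst_adams_of_mem ψ hg) hs]
  rw [plethysm]
  congr 1
  funext n
  exact adams_plethysm ψ n hh

theorem X_one_plethysm {g : MvPowerSeries ℕ+ R} (hg : g ∈ weightIdeal R PNat.val 1) :
    plethysm ψ (X 1) g = g := by
  rw [plethysm, subst_X (hasSubst_adams_of_mem ψ hg), adams_one_left]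

theorem plethysm_X_one (f : MvPowerSeries ℕ+ R) : plethysm ψ f (X 1) = f := by
  simp only [plethysm, adams_X, mul_one]
  exact congrFun subst_self f

theorem plethysm_mem_weightIdeal {N : ℕ} {f g : MvPowerSeries ℕ+ R}
    (hf : f ∈ weightIdeal R PNat.val N) (hg : g ∈ weightIdeal R PNat.val 1) :
    plethysm ψ f g ∈ weightIdeal R PNat.val N :=
  subst_mem_weightIdeal (hasSubst_adams_of_mem ψ hg)
    (fun n => by simpa using adams_mem_weightIdeal ψ n hg) hf

theorem plethysm_left_inverse_eq_right_inverse {f g h : MvPowerSeries ℕ+ R}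
    (hf : f ∈ weightIdeal R PNat.val 1) (hh : h ∈ weightIdeal R PNat.val 1)
    (hgf : plethysm ψ g f = X 1) (hfh : plethysm ψ f h = X 1) : g = h :=
  calc g = plethysm ψ g (plethysm ψ f h) := by rw [hfh, plethysm_X_one]
    _ = h := by rw [plethysm_assoc ψ hf hh, hgf, X_one_plethysm ψ hh]

/-- A series `p₁ - G`, with `G` of weight at least two, has a right inverse of the same form. -/
theorem exists_plethysm_right_inverse {G : MvPowerSeries ℕ+ R}
    (hG : G ∈ weightIdeal R PNat.val 2) :
    ∃ G' ∈ weightIdeal R PNat.val 2, plethysm ψ (X 1 - G) (X 1 - G') = X 1 := by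
  have hX : (X 1 : MvPowerSeries ℕ+ R) ∈ weightIdeal R PNat.val 1 := X_mem_weightIdeal 1
  have hiff : ∀ q : Unit → MvPowerSeries ℕ+ R, (∀ i d, weight PNat.val d < 1 → coeff d (q i) = 0) ↔
    q () ∈ weightIdeal R PNat.val 1 := fun q => ⟨fun h => h (), fun h _ => h⟩
  have hfp := exists_fixedPoint (ι := Unit) (S := R)
    -- The unknown starts in weight 1, so precision is counted from there; the truncated subtraction
    -- is harmless since weight 0 is excluded by the vanishing condition.
    (fun _ d => weight PNat.val d - 1) (fun _ d => weight PNat.val d < 1)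
    (fun q _ => X 1 + plethysm ψ G (q ()))
    (fun q hq _ => add_mem hX
      (weightIdeal_anti one_le_two (plethysm_mem_weightIdeal ψ hG ((hiff q).mp hq))))
  obtain ⟨q, hq, hqT⟩ := hfp <| by
    intro q q' hq hq' n h _ d hd
    rw [hiff] at hq hq'
    have hsub : q () - q' () ∈ weightIdeal R PNat.val (1 + n) := by
      intro e he
      by_cases h1 : weight PNat.val e < 1
      · rw [map_sub, hq e h1, hq' e h1, sub_zero]
      · rw [map_sub, h () e (by lia), sub_self]
    have hadams (i : ℕ+) : adams ψ i (q ()) - adams ψ i (q' ()) ∈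
        weightIdeal R PNat.val (i + n) := by
      rw [← adamsHom_apply, ← adamsHom_apply, ← map_sub]
      -- The operation `ψᵢ` multiplies weights by `i`, and `i(1 + n) ≥ i + n`.
      exact weightIdeal_anti (by nlinarith [i.pos]) (adams_mem_weightIdeal ψ i hsub)
    have := subst_sub_mem_weightIdeal (hasSubst_adams_of_mem ψ hq) (hasSubst_adams_of_mem ψ hq')
      (fun i => by simpa using adams_mem_weightIdeal ψ i hq)
      (fun i => by simpa using adams_mem_weightIdeal ψ i hq') hadams hG d (by lia)
    rw [map_sub, sub_eq_zero] at this
    rw [map_add, map_add]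
    exact congrArg _ this
  have hq1 := (hiff q).mp hq
  have hfix : X 1 + plethysm ψ G (q ()) = q () := congrFun hqT ()
  refine ⟨-plethysm ψ G (q ()), neg_mem (plethysm_mem_weightIdeal ψ hG hq1), ?_⟩
  have hs := hasSubst_adams_of_mem ψ hq1
  rw [sub_neg_eq_add, hfix, plethysm, subst_sub hs, ← plethysm, ← plethysm,
    X_one_plethysm ψ hq1]
  linear_combination -hfix

theorem existsUnique_isPlethysticInverse {G : MvPowerSeries ℕ+ R}
    (hG : G ∈ weightIdeal R PNat.val 2) : ∃! c, IsPlethysticInverse ψ (X 1 - G) c := by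
  have hX : (X 1 : MvPowerSeries ℕ+ R) ∈ weightIdeal R PNat.val 1 := X_mem_weightIdeal 1
  have mem1 : ∀ {G : MvPowerSeries ℕ+ R}, G ∈ weightIdeal R PNat.val 2 →
    X 1 - G ∈ weightIdeal R PNat.val 1 := fun h => sub_mem hX (weightIdeal_anti one_le_two h)
  obtain ⟨G₁, hG₁, h₁⟩ := exists_plethysm_right_inverse ψ hG
  obtain ⟨G₂, hG₂, h₂⟩ := exists_plethysm_right_inverse ψ hG₁
  -- The right inverse has a right inverse of its own, which must be the original series.
  have heq := plethysm_left_inverse_eq_right_inverse ψ (mem1 hG₁) (mem1 hG₂) h₁ h₂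
  refine ⟨X 1 - G₁, ⟨mem_weightIdeal_one_iff.mp (mem1 hG), mem_weightIdeal_one_iff.mp (mem1 hG₁),
    h₁, heq ▸ h₂⟩, fun c hc => ?_⟩
  exact plethysm_left_inverse_eq_right_inverse ψ (mem1 hG) (mem1 hG₁) hc.right_comp h₁

variable [Algebra ℚ R] (N : ℕ → (ℕ+ →₀ ℕ) → R)

theorem le_of_coeff_ch_ne_zero {g : ℕ} {ρ : ℕ+ →₀ ℕ} (h : coeff ρ (ch N g) ≠ 0) :
    3 ≤ 2 * g + size ρ := by
  by_contra h'
  exact h (if_neg h')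

theorem pderiv_one_ch_mem : pderiv R 1 (ch N 0) ∈ weightIdeal R PNat.val 2 := by
  intro d hd
  by_contra h
  have := le_of_coeff_ch_ne_zero N (coeff_pderiv_ne_zero h)
  rw [size_add_single, ← weight_val_eq_size, PNat.one_coe] at this
  lia

end Plethysm

end StableModule

/-! ### Contracting systems: uniqueness and existence -/

namespace StableModule

open Finsupp

/-- A maximal counterexample exists because there are finitely many. Substitutability supplies this
finiteness for the vanishing of a given coefficient. -/
theorem downward_induction {p : ℕ+ → Prop} (hfin : {m | ¬ p m}.Finite)
    (h : ∀ m, (∀ i, m < i → p i) → p m) (m : ℕ+) : p m := by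
  by_contra hm
  obtain ⟨k, hk⟩ := hfin.exists_maximal ⟨m, hm⟩
  refine hk.prop (h k fun i hi => ?_)
  by_contra hpi
  exact (hi.trans_le (hk.le_of_ge hpi hi.le)).false

/-- The weights of the variables `ħ` (weight two) and `pₘ` (weight `m`). -/
def hbarWeight : Option ℕ+ → ℕ := fun v => v.elim 2 PNat.val

/-- Values for `ħ` and for the remaining variables. -/
def extend {α : Type*} (H : α) (q : ℕ+ → α) (v : Option ℕ+) : α := v.elim H q

@[simp] theorem extend_none {α : Type*} (H : α) (q : ℕ+ → α) : extend H q none = H := rfl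

@[simp] theorem extend_some {α : Type*} (H : α) (q : ℕ+ → α) (m : ℕ+) :
    extend H q (some m) = q m := rfl

theorem extend_comp_some {α : Type*} (H : α) (q : ℕ+ → α) :
    extend H q ∘ Function.Embedding.some = q := rfl

section

variable {K τ : Type*} [CommRing K]

theorem hasSubst_extend {H : MvPowerSeries τ K} {q : ℕ+ → MvPowerSeries τ K}
    (hH : constantCoeff H = 0) (hq : HasSubst q) : HasSubst (extend H q) where
  const_coeff v := by
    cases v with
    | none => simp [hH]
    | some m => exact hq.const_coeff m
  coeff_zero d := by
    refine ((Set.finite_singleton none).union ((hq.coeff_zero d).image some)).subset ?_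
    rintro (_ | m) hm
    · exact Or.inl rfl
    · exact Or.inr ⟨m, hm, rfl⟩

/-- The right-hand sides `Φₘ(ħ, q)` of a system `qₘ = Pₘ + Φₘ(ħ, q)` that is contracting for the
weights, and in which small powers of `ħ` occur only in special monomials. -/
structure IsContracting (Φ : ℕ+ → MvPowerSeries (Option ℕ+) K) : Prop where
  weight_lt : ∀ m : ℕ+, Φ m ∈ weightIdeal K hbarWeight (m + 1)
  form : ∀ (m : ℕ+) e, coeff e (Φ m) ≠ 0 →
    (e none = 0 ∧ ∀ i : ℕ+, e (some i) ≠ 0 → m ≤ i) ∨ (m : ℕ) ≤ 2 * e none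

/-- The family `q` solves `qₘ = Pₘ + Φₘ(H, q)`. -/
def SolvesSystem (Φ : ℕ+ → MvPowerSeries (Option ℕ+) K) (H : MvPowerSeries τ K)
    (P q : ℕ+ → MvPowerSeries τ K) : Prop :=
  ∀ m, q m = P m + subst (extend H q) (Φ m)

variable {Φ : ℕ+ → MvPowerSeries (Option ℕ+) K} {H : MvPowerSeries τ K}
  {P q q' : ℕ+ → MvPowerSeries τ K}

theorem IsContracting.lt_weight (hΦ : IsContracting Φ) {m : ℕ+} {e : Option ℕ+ →₀ ℕ}
    (he : coeff e (Φ m) ≠ 0) : m < weight hbarWeight e := by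
  by_contra h
  exact he (hΦ.weight_lt m e (by lia))

/-- Otherwise `form` leaves only the monomials `1` and `qₘ`, whose weights `0` and `m` are too
small. -/
theorem IsContracting.exists_exponent (hΦ : IsContracting Φ) {m : ℕ+} {e : Option ℕ+ →₀ ℕ}
    (he : coeff e (Φ m) ≠ 0) :
    e none ≠ 0 ∨ 2 ≤ e (some m) ∨ ∃ i, m < i ∧ e (some i) ≠ 0 := by
  by_contra! h
  obtain ⟨h0, h1, h2⟩ := h
  have hsupp : e = single (some m) (e (some m)) := by
    ext v
    rcases v with _ | i
    · simp [h0]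
    · rcases lt_trichotomy m i with hi | rfl | hi
      · rw [h2 i hi, single_apply, if_neg (by simpa using hi.ne)]
      · simp
      · rw [single_apply, if_neg (by simpa using hi.ne')]
        rcases hΦ.form m e he with h | h
        · by_contra hne
          exact (h.2 i hne).not_gt hi
        · have := m.pos
          lia
  have hlt := hΦ.lt_weight he
  rw [hsupp, weight_single] at hlt
  have : e (some m) = 0 ∨ e (some m) = 1 := by lia
  rcases this with h | h <;> simp [h, hbarWeight] at hlt

/-- Once the constant terms of all `qᵢ` with `i > m` vanish, the equation puts the constant term `c`
of `qₘ` in the ideal `(c²)`; a nilpotent `c` with this property is zero. -/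
theorem SolvesSystem.constantCoeff_eq_zero (h : SolvesSystem Φ H P q) (hΦ : IsContracting Φ)
    (hH : constantCoeff H = 0) (hP : ∀ m, constantCoeff (P m) = 0) (hq : HasSubst q) (m : ℕ+) :
    constantCoeff (q m) = 0 := by
  refine downward_induction (p := fun m => constantCoeff (q m) = 0) (hq.coeff_zero 0)
    (fun m ih => ?_) m
  obtain ⟨J, hJ⟩ : ∃ J, J = Ideal.span {constantCoeff (q m) ^ 2} := ⟨_, rfl⟩
  have hmem : constantCoeff (q m) ∈ J := by
    rw [h m, map_add, hP, zero_add, constantCoeff_subst (hasSubst_extend hH hq)]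
    refine finsum_induction (p := fun x => x ∈ J) (zero_mem _) (fun _ _ => add_mem) fun e => ?_
    by_cases he : coeff e (Φ m) = 0
    · rw [he, zero_smul]
      exact zero_mem _
    rw [smul_eq_mul]
    refine J.mul_mem_left _ ?_
    rw [map_finsuppProd, hJ, Ideal.mem_span_singleton]
    have hdvd : ∀ v, e v ≠ 0 → constantCoeff (extend H q v) ^ e v ∣
        e.prod fun v r => constantCoeff (extend H q v ^ r) := fun v hv => by
      rw [← map_pow]
      exact Finset.dvd_prod_of_mem (fun v => constantCoeff (extend H q v ^ e v))
        (mem_support_iff.mpr hv)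
    rcases hΦ.exists_exponent he with hv | hv | ⟨i, hi, hv⟩
    · refine Dvd.dvd.trans ?_ (hdvd none hv)
      simp [hH, zero_pow hv]
    · exact (pow_dvd_pow _ hv).trans (hdvd (some m) (by lia))
    · refine Dvd.dvd.trans ?_ (hdvd (some i) hv)
      simp [ih i hi, zero_pow hv]
  obtain ⟨b, hb⟩ := Ideal.mem_span_singleton.mp (hJ ▸ hmem)
  obtain ⟨n, hn⟩ := hq.const_coeff m
  -- Iterate `c = c²b`; a `k` with `c ^ k = 0` finishes.
  have key : ∀ k, constantCoeff (q m) = constantCoeff (q m) ^ (k + 1) * b ^ k := by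
    intro k
    induction k with
    | zero => simp
    | succ k ih =>
      calc constantCoeff (q m) = constantCoeff (q m) ^ k * b ^ k * constantCoeff (q m) := by
            conv_lhs => rw [ih]
            ring
        _ = constantCoeff (q m) ^ k * b ^ k * (constantCoeff (q m) ^ 2 * b) := by rw [← hb]
        _ = _ := by ring
  rw [key n, pow_succ, hn, zero_mul, zero_mul]

theorem eq_zero_of_weight_one_eq_zero {σ : Type*} {e : σ →₀ ℕ}
    (h : weight (fun _ => 1 : σ → ℕ) e = 0) : e = 0 := by
  ext v
  simpa [h] using le_weight (fun _ => 1 : σ → ℕ) (s := v) one_ne_zero e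

theorem eq_single_of_weight_one_eq_one {σ : Type*} {e : σ →₀ ℕ}
    (h : weight (fun _ => 1 : σ → ℕ) e = 1) : ∃ v, e = single v 1 := by
  obtain ⟨v, hv⟩ : ∃ v, e v ≠ 0 := by
    by_contra! h0
    obtain rfl : e = 0 := ext h0
    simp at h
  have hle : single v 1 ≤ e := by
    classical
    intro u
    rw [single_apply]
    split_ifs with huv
    · subst huv
      exact Nat.one_le_iff_ne_zero.mpr hv
    · exact Nat.zero_le _
  refine ⟨v, ?_⟩
  obtain ⟨f, rfl⟩ := exists_add_of_le hle
  rw [map_add, weight_single, smul_eq_mul, mul_one] at h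
  rw [eq_zero_of_weight_one_eq_zero (e := f) (by lia), add_zero]

/-- The induction runs over total degree, and within one degree downwards over `m`. Keeping `H`
arbitrary allows both `H = ħ` and `H = 0`. -/
theorem SolvesSystem.unique (h : SolvesSystem Φ H P q) (h' : SolvesSystem Φ H P q')
    (hΦ : IsContracting Φ) (hH : constantCoeff H = 0) (hP : ∀ m, constantCoeff (P m) = 0)
    (hq : HasSubst q) (hq' : HasSubst q') : q = q' := by
  have mem_one : ∀ {f : MvPowerSeries τ K}, constantCoeff f = 0 →
      f ∈ weightIdeal K (fun _ => 1) 1 := by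
    intro f hf d hd
    rw [eq_zero_of_weight_one_eq_zero (e := d) (by lia)]
    exact hf
  have hq0 := fun m => mem_one (h.constantCoeff_eq_zero hΦ hH hP hq m)
  have hq0' := fun m => mem_one (h'.constantCoeff_eq_zero hΦ hH hP hq' m)
  have mem_extend : ∀ {r : ℕ+ → MvPowerSeries τ K}, (∀ m, r m ∈ weightIdeal K (fun _ => 1) 1) →
      ∀ v, extend H r v ∈ weightIdeal K (fun _ => 1) 1 := by
    rintro r hr (_ | m)
    exacts [mem_one hH, hr m]
  suffices hn : ∀ n m, q m - q' m ∈ weightIdeal K (fun _ => 1) (n + 1) by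
    funext m
    refine sub_eq_zero.mp (ext fun d => ?_)
    exact hn (weight (fun _ => 1) d) m d (by lia)
  intro n
  induction n with
  | zero => exact fun m => sub_mem (hq0 m) (hq0' m)
  | succ n ih =>
    intro m d hd
    by_cases hdn : weight (fun _ => 1) d < n + 1
    · exact ih m d hdn
    refine downward_induction (p := fun m => coeff d (q m - q' m) = 0)
      (((hq.coeff_zero d).union (hq'.coeff_zero d)).subset fun i hi => ?_) (fun m ihm => ?_) m
    · by_contra h0
      simp only [Set.mem_union, Set.mem_ofPred_eq, not_or, not_not] at h0
      exact hi (by rw [map_sub, h0.1, h0.2, sub_zero])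
    have hs := hasSubst_extend hH hq
    have hs' := hasSubst_extend hH hq'
    rw [h m, h' m, add_sub_add_left_eq_sub, map_sub, coeff_subst hs, coeff_subst hs', sub_eq_zero]
    refine finsum_congr fun e => ?_
    by_cases he : coeff e (Φ m) = 0
    · rw [he, zero_smul, zero_smul]
    congr 1
    rw [← sub_eq_zero, ← map_sub]
    -- In a monomial of degree at least two the other factors, having no constant term, raise the
    -- order of the difference to `n + 2`. A linear monomial is `ħ`, where nothing changes, or `qᵢ`
    -- with `i > m` by weight, covered by the descending induction.
    by_cases he2 : 2 ≤ weight (fun _ => 1) e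
    · refine prod_pow_sub_mem_weightIdeal (w := fun _ => 1) (v := fun _ => 1) (n := n)
        (mem_extend hq0) (mem_extend hq0') ?_ e d (by lia)
      rintro (_ | i)
      · simp
      · rw [add_comm]
        exact ih i
    · have hne : weight (fun _ => 1) e ≠ 0 := fun h0 => by
        have := hΦ.lt_weight he
        rw [eq_zero_of_weight_one_eq_zero h0, map_zero] at this
        lia
      obtain ⟨v, rfl⟩ := eq_single_of_weight_one_eq_one (e := e) (by lia)
      rw [prod_single_index (by simp), prod_single_index (by simp), pow_one, pow_one]
      rcases v with _ | i
      · simp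
      · refine ihm i ?_
        have := hΦ.lt_weight he
        rw [weight_single, one_smul] at this
        exact this

variable (K) in
/-- The power series in which powers `ħ^s` with `0 < s < m / 2` do not occur. -/
def formSubring (m : ℕ) : Subring (MvPowerSeries (Option ℕ+) K) where
  carrier := {f | ∀ d, d none ≠ 0 → 2 * d none < m → coeff d f = 0}
  zero_mem' _ _ _ := map_zero _
  one_mem' d hd _ := by
    classical
    rw [coeff_one, if_neg]
    rintro rfl
    exact hd rfl
  add_mem' hf hg d hd hm := by rw [map_add, hf d hd hm, hg d hd hm, add_zero]
  neg_mem' hf d hd hm := by rw [map_neg, hf d hd hm, neg_zero]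
  mul_mem' {f g} hf hg d hd hm := by
    classical
    rw [coeff_mul]
    refine Finset.sum_eq_zero fun x hx => ?_
    rw [← Finset.HasAntidiagonal.mem_antidiagonal.mp hx, Finsupp.add_apply] at hd hm
    by_cases h1 : x.1 none = 0
    · rw [hg x.2 (by lia) (by lia), mul_zero]
    · rw [hf x.1 h1 (by lia), zero_mul]

theorem formSubring_anti {m n : ℕ} (h : m ≤ n) : formSubring K n ≤ formSubring K m :=
  fun _ hf d hd hm => hf d hd (hm.trans_le h)

theorem X_none_mul_mem_formSubring {m s : ℕ} (h : m ≤ 2 * s) (f : MvPowerSeries (Option ℕ+) K) :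
    X none ^ s * f ∈ formSubring K m := fun d _ hm =>
  X_pow_dvd_iff.mp (dvd_mul_right _ _) d (by lia)

/-- A monomial of the first kind involves only `qᵢ` with `i ≥ m`, whose forms are at least as
restrictive; one of the second kind is divisible by a power of `ħ` that is large enough. -/
theorem IsContracting.subst_mem_formSubring (hΦ : IsContracting Φ)
    {q : ℕ+ → MvPowerSeries (Option ℕ+) K} (hq : HasSubst q)
    (hform : ∀ m : ℕ+, q m ∈ formSubring K m) (m : ℕ+) :
    subst (extend (X none) q) (Φ m) ∈ formSubring K m := by
  intro d hd hm
  rw [coeff_subst (hasSubst_extend (by simp) hq)]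
  refine finsum_eq_zero_of_forall_eq_zero fun e => ?_
  by_cases he : coeff e (Φ m) = 0
  · rw [he, zero_smul]
  suffices h : (e.prod fun v r => extend (X none) q v ^ r) ∈ formSubring K m by
    rw [h d hd hm, smul_zero]
  rcases hΦ.form m e he with h | h
  · refine Subring.prod_mem _ fun v hv => Subring.pow_mem _ ?_ _
    rcases v with _ | i
    · exact absurd h.1 (mem_support_iff.mp hv)
    · exact formSubring_anti (PNat.coe_le_coe _ _ |>.mpr (h.2 i (mem_support_iff.mp hv))) (hform i)
  · have hn : none ∈ e.support := by
      rw [mem_support_iff]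
      have := m.pos
      lia
    rw [Finsupp.prod, ← Finset.mul_prod_erase _ _ hn]
    exact X_none_mul_mem_formSubring h _

theorem exists_solvesSystem (hΦ : IsContracting Φ) {P : ℕ+ → MvPowerSeries (Option ℕ+) K}
    (hP : ∀ m : ℕ+, P m ∈ weightIdeal K hbarWeight m) (hP' : ∀ m : ℕ+, P m ∈ formSubring K m) :
    ∃ q, HasSubst q ∧ SolvesSystem Φ (X none) P q ∧ ∀ m : ℕ+, q m ∈ formSubring K m := by
  have hfp := exists_fixedPoint (ι := ℕ+) (S := K)
    -- Precision is measured relative to the minimal weight `m` of the `m`-th unknown.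
    (fun (m : ℕ+) (d : Option ℕ+ →₀ ℕ) => weight hbarWeight d - m)
    (fun (m : ℕ+) (d : Option ℕ+ →₀ ℕ) => weight hbarWeight d < m ∨ (d none ≠ 0 ∧ 2 * d none < m))
    (fun q m => P m + subst (extend (X none) q) (Φ m))
  have hZ : ∀ q : ℕ+ → MvPowerSeries (Option ℕ+) K, (∀ (m : ℕ+) (d : Option ℕ+ →₀ ℕ),
      (weight hbarWeight d < m ∨ (d none ≠ 0 ∧ 2 * d none < m)) → coeff d (q m) = 0) ↔
      (∀ m : ℕ+, q m ∈ weightIdeal K hbarWeight m) ∧ ∀ m : ℕ+, q m ∈ formSubring K m :=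
    fun q => ⟨fun h => ⟨fun m d hd => h m d (Or.inl hd), fun m d h1 h2 => h m d (Or.inr ⟨h1, h2⟩)⟩,
      fun h m d hd => hd.elim (h.1 m d) fun h' => h.2 m d h'.1 h'.2⟩
  have mem_extend : ∀ {r : ℕ+ → MvPowerSeries (Option ℕ+) K},
      (∀ m : ℕ+, r m ∈ weightIdeal K hbarWeight m) →
      ∀ v, extend (X none) r v ∈ weightIdeal K hbarWeight (hbarWeight v) := by
    rintro r hr (_ | m)
    exacts [X_mem_weightIdeal none, hr m]
  have hsub : ∀ {r : ℕ+ → MvPowerSeries (Option ℕ+) K},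
      (∀ m : ℕ+, r m ∈ weightIdeal K hbarWeight m) → HasSubst (extend (X none) r) :=
    fun hr => hasSubst_extend (by simp) (hasSubst_of_mem_weightIdeal hr)
  simp only [hZ] at hfp
  obtain ⟨q, ⟨hq, hform⟩, hqT⟩ := hfp
    (fun q ⟨hq, hform⟩ => ⟨fun m => add_mem (hP m) (weightIdeal_anti (Nat.le_succ _)
      (subst_mem_weightIdeal (hsub hq) (mem_extend hq) (hΦ.weight_lt m))),
      fun m => add_mem (hP' m)
        (hΦ.subst_mem_formSubring (hasSubst_of_mem_weightIdeal hq) hform m)⟩) <| by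
    rintro q q' ⟨hq, -⟩ ⟨hq', -⟩ n hagree m d hd
    have hdiff : ∀ i : ℕ+, q i - q' i ∈ weightIdeal K hbarWeight (i + n) := by
      intro i e he
      by_cases h1 : weight hbarWeight e < i
      · rw [map_sub, hq i e h1, hq' i e h1, sub_zero]
      · rw [map_sub, hagree i e (by lia), sub_self]
    have := subst_sub_mem_weightIdeal (n := n) (hsub hq) (hsub hq') (mem_extend hq)
      (mem_extend hq') (by
        rintro (_ | i)
        · simp
        · exact hdiff i) (hΦ.weight_lt m) d (by lia)
    rw [map_sub, sub_eq_zero] at this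
    rw [map_add, map_add, this]
  exact ⟨q, hasSubst_of_mem_weightIdeal hq, fun m => (congrFun hqT m).symm, hform⟩

end

end StableModule

namespace StableModule

open Finsupp hiding some
open WithPiTopology

/-! ### Formal sums commute with continuous operations -/

section FormalSum

variable {σ τ K : Type*} [CommRing K]

theorem coeff_formalSum (F : ℕ → MvPowerSeries σ K) (d : σ →₀ ℕ) :
    coeff d (formalSum F) = ∑ᶠ g, coeff d (F g) := rfl

theorem exists_of_coeff_formalSum_ne_zero {F : ℕ → MvPowerSeries σ K} {d : σ →₀ ℕ}
    (h : coeff d (formalSum F) ≠ 0) : ∃ g, coeff d (F g) ≠ 0 := by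
  contrapose! h
  exact finsum_eq_zero_of_forall_eq_zero h

theorem formalSum_eq_of_forall_ne {F : ℕ → MvPowerSeries σ K} (g : ℕ) (h : ∀ g' ≠ g, F g' = 0) :
    formalSum F = F g := by
  ext d
  rw [coeff_formalSum, finsum_eq_single _ g fun g' hg' => by rw [h g' hg', map_zero]]

theorem hasSum_formalSum [TopologicalSpace K] {F : ℕ → MvPowerSeries σ K}
    (hF : ∀ d, {g | coeff d (F g) ≠ 0}.Finite) : HasSum F (formalSum F) := by
  rw [hasSum_iff_hasSum_coeff]
  intro d
  rw [coeff_formalSum, finsum_eq_sum _ (hF d)]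
  refine hasSum_sum_of_ne_finset_zero fun g hg => ?_
  by_contra h
  exact hg ((Set.Finite.mem_toFinset _).mpr h)

theorem formalSum_eq_of_hasSum [TopologicalSpace K] [DiscreteTopology K]
    {F : ℕ → MvPowerSeries σ K} {f : MvPowerSeries σ K} (h : HasSum F f) : formalSum F = f := by
  ext d
  have hd := hasSum_iff_hasSum_coeff.mp h d
  rw [coeff_formalSum, ← hd.tsum_eq, tsum_eq_finsum]
  exact hd.summable.hasFiniteSupport_of_discreteTopology

theorem map_formalSum [TopologicalSpace K] [DiscreteTopology K] {F : ℕ → MvPowerSeries σ K}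
    (hF : ∀ d, {g | coeff d (F g) ≠ 0}.Finite) (φ : MvPowerSeries σ K →+ MvPowerSeries τ K)
    (hφ : Continuous φ) : φ (formalSum F) = formalSum fun g => φ (F g) :=
  (formalSum_eq_of_hasSum ((hasSum_formalSum hF).map φ hφ)).symm

theorem subst_formalSum {F : ℕ → MvPowerSeries σ K} (hF : ∀ d, {g | coeff d (F g) ≠ 0}.Finite)
    {a : σ → MvPowerSeries τ K} (ha : HasSubst a) :
    subst a (formalSum F) = formalSum fun g => subst a (F g) := by
  let : UniformSpace K := ⊥
  have := map_formalSum hF (substAlgHom (R := K) ha : MvPowerSeries σ K →+ MvPowerSeries τ K)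
    (by simpa using continuous_subst ha)
  simpa using this

theorem pderiv_formalSum {F : ℕ → MvPowerSeries σ K} (hF : ∀ d, {g | coeff d (F g) ≠ 0}.Finite)
    (i : σ) : pderiv K i (formalSum F) = formalSum fun g => pderiv K i (F g) := by
  let : UniformSpace K := ⊥
  exact map_formalSum hF ((pderiv K i : MvPowerSeries σ K →ₗ[K] MvPowerSeries σ K).toAddMonoidHom)
    (continuous_pderiv i)

theorem mul_formalSum {F : ℕ → MvPowerSeries σ K} (hF : ∀ d, {g | coeff d (F g) ≠ 0}.Finite)
    (f : MvPowerSeries σ K) : f * formalSum F = formalSum fun g => f * F g := by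
  let : UniformSpace K := ⊥
  exact map_formalSum hF (AddMonoidHom.mulLeft f) (continuous_const.mul continuous_id)

theorem finite_coeff_X_pow_mul_ne_zero (v : σ) (k : ℕ+) (c : ℕ) (A : ℕ → MvPowerSeries σ K)
    (d : σ →₀ ℕ) : {g | coeff d (X v ^ (k * g + c) * A g) ≠ 0}.Finite := by
  refine (Set.finite_Iic (d v)).subset fun g hg => ?_
  by_contra h
  refine hg (X_pow_dvd_iff.mp (dvd_mul_right _ _) d ?_)
  have := k.pos
  simp only [Set.mem_Iic, not_le] at h
  nlinarith

end FormalSum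

/-! ### The critical-point system as a contracting system -/

variable {R K : Type*} [CommRing R] [CommRing K]

theorem pderiv_adams (ψ : ℕ+ →* (R →+* R)) (k j : ℕ+) (f : MvPowerSeries ℕ+ R) :
    pderiv R (k * j) (adams ψ k f) = adams ψ k (pderiv R j f) := by
  rw [adams, adams, map_pderiv, ← pderiv_rename]
  rfl

theorem pderiv_adams_of_not_dvd (ψ : ℕ+ →* (R →+* R)) {k m : ℕ+} (h : ¬ k ∣ m)
    (f : MvPowerSeries ℕ+ R) : pderiv R m (adams ψ k f) = 0 :=
  pderiv_rename_of_notMem _ (by rintro ⟨j, rfl⟩; exact h (dvd_mul_right k j)) _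

variable (K) in
/-- The part `pₘ + εₘ ħ^{m/2}` of the system that does not involve the unknowns. -/
noncomputable def source (m : ℕ+) : MvPowerSeries (Option ℕ+) K :=
  X (some m) + (eps m : MvPowerSeries (Option ℕ+) K) * X none ^ ((m : ℕ) / 2)

theorem coeff_X_none_pow_mul_rename {s : ℕ} {f : MvPowerSeries ℕ+ K} {e : Option ℕ+ →₀ ℕ}
    (h : coeff e (X none ^ s * rename Function.Embedding.some f) ≠ 0) :
    e none = s ∧ coeff e.some f ≠ 0 := by
  classical
  rw [X_pow_eq, coeff_monomial_mul, one_mul, ite_ne_right_iff] at h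
  obtain ⟨x, hx, hxf⟩ := exists_of_coeff_rename_ne_zero h.2
  have hsum : e = single none s + embDomain Function.Embedding.some x := by
    rw [hx, add_tsub_cancel_of_le h.1]
  constructor
  · rw [hsum, Finsupp.add_apply, single_eq_same, embDomain_of_notMem_range _ _ _ (by simp),
      add_zero]
  · convert hxf
    ext i
    rw [some_apply, hsum, Finsupp.add_apply, single_eq_of_ne (by simp), zero_add]
    exact embDomain_apply_self Function.Embedding.some x i

theorem weight_hbarWeight (e : Option ℕ+ →₀ ℕ) :
    weight hbarWeight e = 2 * e none + size e.some := by
  rw [← weight_val_eq_size, weight_apply, weight_apply,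
    sum_option_index _ _ (by simp) (by intros; simp [add_mul])]
  simp [hbarWeight, mul_comm]

theorem eps_of_odd {m : ℕ+} (h : ¬ Even (m : ℕ)) : eps m = 0 := if_neg h

theorem eps_of_even {m : ℕ+} (h : Even (m : ℕ)) : eps m = 1 := if_pos h

theorem source_mem_weightIdeal (m : ℕ+) : source K m ∈ weightIdeal K hbarWeight m := by
  refine add_mem (X_mem_weightIdeal (some m)) ?_
  by_cases h : Even (m : ℕ)
  · have := pow_mem_weightIdeal (S := K) (X_mem_weightIdeal (w := hbarWeight) none) ((m : ℕ) / 2)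
    rw [show (m : ℕ) / 2 * hbarWeight none = m from Nat.div_mul_cancel h.two_dvd] at this
    exact Ideal.mul_mem_left _ _ this
  · rw [eps_of_odd h, Nat.cast_zero, zero_mul]
    exact zero_mem _

theorem source_mem_formSubring (m : ℕ+) : source K m ∈ formSubring K m := by
  refine add_mem (fun d hd _ => ?_) ?_
  · classical
    rw [coeff_X, if_neg]
    rintro rfl
    exact hd (single_eq_of_ne (by simp))
  · by_cases h : Even (m : ℕ)
    · rw [mul_comm]
      exact X_none_mul_mem_formSubring (by rw [Nat.mul_div_cancel' h.two_dvd]) _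
    · rw [eps_of_odd h, Nat.cast_zero, zero_mul]
      exact zero_mem _

theorem constantCoeff_source (m : ℕ+) : constantCoeff (source K m) = 0 :=
  source_mem_weightIdeal m 0 (by simp)

theorem hasForm_iff {q : ℕ+ → MvPowerSeries (Option ℕ+) K} :
    HasForm q ↔ ∀ m : ℕ+, q m ∈ formSubring K m := by
  -- The bound `(m + 1 - εₘ)/2` is `m/2` rounded up.
  have key : ∀ (m : ℕ+) (s : ℕ), s < ((m : ℕ) + 1 - eps m) / 2 ↔ 2 * s < m := by
    intro m s
    by_cases h : Even (m : ℕ)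
    · rw [eps_of_even h]
      obtain ⟨r, hr⟩ := h
      lia
    · rw [eps_of_odd h]
      obtain ⟨r, hr⟩ := Nat.not_even_iff_odd.mp h
      lia
  refine forall_congr' fun m => ⟨fun h d hd hm => ?_, fun h s hs hm => ?_⟩
  · have := congrArg (coeff d.some) (h (d none) (Nat.pos_of_ne_zero hd) ((key m _).mpr hm))
    rw [map_zero] at this
    rw [← this, ← d.optionElim_some]
    simp [hbarCoeff, coeff_apply]
  · ext d
    exact h (d.optionElim s) (by simpa using hs.ne') (by simpa using (key m s).mp hm)

/-- The substitution of `q` for the variables `qₘ` of `𝒦`. -/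
noncomputable def kappaSubst (q : ℕ+ → MvPowerSeries (Option ℕ+) K) (v : Option (ℕ+ ⊕ ℕ+)) :
    MvPowerSeries (Option ℕ+) K :=
  v.elim (X none) (Sum.elim (fun j => X (some j)) q)

theorem hasSubst_kappaSubst {q : ℕ+ → MvPowerSeries (Option ℕ+) K} (hq : HasSubst q) :
    HasSubst (kappaSubst q) where
  const_coeff v := by
    rcases v with _ | j | m
    · simp [kappaSubst]
    · simp [kappaSubst]
    · exact hq.const_coeff m
  coeff_zero d := by
    have hX := (HasSubst.X (σ := Option ℕ+) (S := K)).coeff_zero d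
    refine ((Set.finite_singleton none).union (((hX.preimage
      (Option.some_injective ℕ+).injOn).image (some ∘ Sum.inl)).union
        ((hq.coeff_zero d).image (some ∘ Sum.inr)))).subset ?_
    rintro (_ | j | m) hm
    · exact Or.inl rfl
    · exact Or.inr (Or.inl ⟨j, hm, rfl⟩)
    · exact Or.inr (Or.inr ⟨m, hm, rfl⟩)

variable [Algebra ℚ R] (ψ : ℕ+ →* (R →+* R)) (π : R →+* K)
  (N : ℕ → (ℕ+ →₀ ℕ) → R)

theorem pderiv_psiCh (k j : ℕ+) (g : ℕ) :
    pderiv K (k * j) (psiCh ψ π N k g) = map π (adams ψ k (pderiv R j (ch N g))) := by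
  rw [psiCh, ← map_pderiv, pderiv_adams]

theorem pderiv_psiCh_of_not_dvd {k m : ℕ+} (h : ¬ k ∣ m) (g : ℕ) :
    pderiv K m (psiCh ψ π N k g) = 0 := by
  rw [psiCh, ← map_pderiv, pderiv_adams_of_not_dvd ψ h, map_zero]

variable [Algebra ℚ K]

/-- The part of the system involving the unknowns, as power series in `ħ` and the `q`'s. -/
noncomputable def interaction (m : ℕ+) : MvPowerSeries (Option ℕ+) K :=
  ∑ k ∈ (Finset.Icc 1 m).filter (fun k : ℕ+ => (k : ℕ) ∣ (m : ℕ)),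
    ((m : ℕ) / (k : ℕ) : ℚ) • formalSum fun g =>
      X none ^ ((k : ℕ) * g + ((m : ℕ) - (k : ℕ))) *
        rename Function.Embedding.some (pderiv K m (psiCh ψ π N k g))

theorem subst_interaction {τ : Type*} {H : MvPowerSeries τ K} {q : ℕ+ → MvPowerSeries τ K}
    (hH : constantCoeff H = 0) (hq : HasSubst q) (m : ℕ+) :
    subst (extend H q) (interaction ψ π N m) =
      ∑ k ∈ (Finset.Icc 1 m).filter (fun k : ℕ+ => (k : ℕ) ∣ (m : ℕ)),
        ((m : ℕ) / (k : ℕ) : ℚ) • formalSum fun g =>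
          H ^ ((k : ℕ) * g + ((m : ℕ) - (k : ℕ))) *
            subst q (pderiv K m (psiCh ψ π N k g)) := by
  have hs := hasSubst_extend hH hq
  rw [interaction, ← substAlgHom_apply hs, map_sum]
  refine Finset.sum_congr rfl fun k _ => ?_
  rw [substAlgHom_apply, subst_smul hs,
    subst_formalSum (finite_coeff_X_pow_mul_ne_zero _ _ _ _) hs]
  simp only [subst_mul hs, subst_pow hs, subst_X hs, subst_rename _ hs, extend_comp_some,
    extend_none]

theorem isFormalSolution_iff {q : ℕ+ → MvPowerSeries (Option ℕ+) K} :
    IsFormalSolution ψ π N q ↔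
      HasSubst q ∧ SolvesSystem (interaction ψ π N) (X none) (source K) q := by
  constructor
  · rintro ⟨hq, h⟩
    exact ⟨hq, fun m => by rw [subst_interaction ψ π N (by simp) hq]; exact h m⟩
  · rintro ⟨hq, h⟩
    refine ⟨hq, fun m => ?_⟩
    have := h m
    rwa [subst_interaction ψ π N (by simp) hq] at this

/-- Traces a monomial back to its divisor `k`, genus `g` and stable partition `ρ`; differentiation
by `qₘ` accounts for the added `single m 1`. -/
theorem exists_of_coeff_interaction_ne_zero {m : ℕ+} {e : Option ℕ+ →₀ ℕ}
    (h : coeff e (interaction ψ π N m) ≠ 0) :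
    ∃ (k j : ℕ+) (g : ℕ), m = k * j ∧ e none = k * g + (m - k) ∧
      ∃ ρ : ℕ+ →₀ ℕ, e.some + single m 1 = embDomain (mulLeftEmbedding k) ρ ∧
        3 ≤ 2 * g + size ρ := by
  rw [interaction, map_sum] at h
  obtain ⟨k, hk, hne⟩ := Finset.exists_ne_zero_of_sum_ne_zero h
  obtain ⟨j, rfl⟩ := PNat.dvd_iff.mpr (Finset.mem_filter.mp hk).2
  rw [map_rat_smul] at hne
  obtain ⟨g, hg⟩ := exists_of_coeff_formalSum_ne_zero (right_ne_zero_of_smul hne)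
  obtain ⟨hnone, hsome⟩ := coeff_X_none_pow_mul_rename hg
  have := coeff_pderiv_ne_zero hsome
  rw [psiCh, coeff_map] at this
  obtain ⟨ρ, hρ, hne⟩ := exists_of_coeff_rename_ne_zero fun h0 => this (by rw [adams, h0, map_zero])
  rw [coeff_map] at hne
  exact ⟨k, j, g, rfl, hnone, ρ, hρ.symm,
    le_of_coeff_ch_ne_zero N fun h0 => hne (by rw [h0, map_zero])⟩

/-- The weight is `2(kg + m - k) + k|ρ| - m = m + k(2g + |ρ| - 2) ≥ m + k`. For the form: a proper
divisor `k` gives `m - k ≥ m/2`, while `k = m` and `g ≥ 1` give `kg ≥ m`; in the remaining case `ħ`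
is absent and all indices are multiples of `m`. -/
theorem isContracting_interaction : IsContracting (interaction ψ π N) where
  weight_lt m e he := by
    by_contra h
    obtain ⟨k, j, g, hm, hnone, ρ, hρ, h3⟩ := exists_of_coeff_interaction_ne_zero ψ π N h
    have hsize := congrArg size hρ
    rw [size_add_single, size_embDomain] at hsize
    rw [weight_hbarWeight, hnone] at he
    have hkm : (k : ℕ) ≤ m := by
      rw [hm, PNat.mul_coe]
      exact Nat.le_mul_of_pos_right _ j.pos
    have hk := k.pos
    have := Nat.mul_le_mul_left (k : ℕ) h3
    rw [mul_add, ← hsize] at this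
    have h2 : (k : ℕ) * (2 * g) = 2 * (k * g) := by ring
    lia
  form m e h := by
    obtain ⟨k, j, g, hm, hnone, ρ, hρ, h3⟩ := exists_of_coeff_interaction_ne_zero ψ π N h
    have hk := k.pos
    have hm' : (m : ℕ) = k * j := by rw [hm, PNat.mul_coe]
    rcases Nat.lt_or_ge 1 (j : ℕ) with hj | hj
    · right
      have := Nat.mul_le_mul_left (k : ℕ) hj
      lia
    obtain rfl : j = 1 := PNat.coe_injective (le_antisymm hj j.pos)
    rw [mul_one] at hm
    subst hm
    rcases Nat.eq_zero_or_pos g with rfl | hg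
    · refine Or.inl ⟨by simpa using hnone, fun i hi => ?_⟩
      have hi' : (e.some + single m 1 : ℕ+ →₀ ℕ) i ≠ 0 := by
        rw [Finsupp.add_apply, some_apply]
        lia
      rw [hρ] at hi'
      have hmem : i ∈ Set.range (mulLeftEmbedding m) := by
        by_contra hmem
        exact hi' (embDomain_of_notMem_range _ _ _ hmem)
      obtain ⟨l, rfl⟩ := hmem
      exact PNat.le_of_dvd (dvd_mul_right m l)
    · right
      have := Nat.mul_le_mul_left (m : ℕ) hg
      lia

theorem existsUnique_isFormalSolution :
    ∃! q : ℕ+ → MvPowerSeries (Option ℕ+) K, IsFormalSolution ψ π N q ∧ HasForm q := by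
  have hΦ := isContracting_interaction ψ π N
  obtain ⟨q, hq, hsol, hform⟩ :=
    exists_solvesSystem hΦ source_mem_weightIdeal source_mem_formSubring
  refine ⟨q, ⟨(isFormalSolution_iff ψ π N).mpr ⟨hq, hsol⟩, hasForm_iff.mpr hform⟩, ?_⟩
  rintro q' ⟨h, -⟩
  obtain ⟨hq', hsol'⟩ := (isFormalSolution_iff ψ π N).mp h
  exact hsol'.unique hsol hΦ (by simp) constantCoeff_source hq' hq

theorem pderiv_kappa (k m : ℕ+) :
    pderiv K (some (.inr m)) (kappa ψ π N k) =
      (if k = m then -(((k : ℕ) : ℚ)⁻¹ • (X (some (.inr k)) - X (some (.inl k)) -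
        (eps k : MvPowerSeries (Option (ℕ+ ⊕ ℕ+)) K) * X none ^ ((k : ℕ) / 2))) else 0) +
      ((k : ℕ) : ℚ)⁻¹ • formalSum fun g => X none ^ ((k : ℕ) * g) *
        rename (Function.Embedding.inr.trans Function.Embedding.some)
          (pderiv K m (psiCh ψ π N k g)) := by
  have hfin : ∀ A : ℕ → MvPowerSeries (Option (ℕ+ ⊕ ℕ+)) K,
      ∀ d, {g | coeff d (X none ^ ((k : ℕ) * g) * A g) ≠ 0}.Finite := fun A => by
    simpa using finite_coeff_X_pow_mul_ne_zero none k 0 A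
  have hnone : ∀ s, pderiv K (some (.inr m))
      (X none ^ s : MvPowerSeries (Option (ℕ+ ⊕ ℕ+)) K) = 0 :=
    fun s => by rw [pderiv_pow, pderiv_X_of_ne (by simp), mul_zero]
  rw [kappa, map_add, map_neg, map_rat_smul, map_rat_smul, pderiv_formalSum (hfin _)]
  congr 1
  · rw [pderiv_pow, map_sub, map_sub, pderiv_X_of_ne (i := some (Sum.inr m)) (j := some (Sum.inl k))
      (by simp), Derivation.leibniz, hnone, Derivation.map_natCast]
    split_ifs with h
    · subst h
      rw [pderiv_X_self, Nat.cast_ofNat]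
      simp only [smul_zero, add_zero, sub_zero, mul_one]
      rw [show 2 - 1 = 1 from rfl, pow_one,
        two_mul (X (some (Sum.inr k)) - _ - _ : MvPowerSeries (Option (ℕ+ ⊕ ℕ+)) K)]
      module
    · rw [pderiv_X_of_ne (by simpa using h)]
      simp
  · congr 2
    funext g
    rw [Derivation.leibniz, hnone, smul_zero, add_zero, smul_eq_mul]
    congr 1
    exact pderiv_rename (Function.Embedding.inr.trans Function.Embedding.some) m _

theorem isCriticalPoint_iff {q : ℕ+ → MvPowerSeries (Option ℕ+) K} (hq : HasSubst q) :
    IsCriticalPoint ψ π N q ↔ IsFormalSolution ψ π N q := by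
  have hs := hasSubst_kappaSubst hq
  have hcomp : kappaSubst q ∘ (Function.Embedding.inr.trans Function.Embedding.some) = q := rfl
  rw [isFormalSolution_iff, and_iff_right hq]
  refine forall_congr' fun m => ?_
  change (∑ k ∈ Finset.Icc 1 m, X none ^ ((m : ℕ) - (k : ℕ)) * subst (kappaSubst q)
    (pderiv K (some (.inr m)) (kappa ψ π N k)) = 0) ↔ _
  have hfin : ∀ (k : ℕ+) {σ : Type} (v : σ) (A : ℕ → MvPowerSeries σ K),
      ∀ d, {g | coeff d (X v ^ ((k : ℕ) * g) * A g) ≠ 0}.Finite := fun k _ v A => by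
    simpa using finite_coeff_X_pow_mul_ne_zero v k 0 A
  -- The common factor `1/m` is extracted by writing `1/k = (1/m)(m/k)`, the origin of the
  -- coefficients `m/k` in the system.
  have hterm : ∀ k ∈ Finset.Icc 1 m, X none ^ ((m : ℕ) - (k : ℕ)) * subst (kappaSubst q)
      (pderiv K (some (.inr m)) (kappa ψ π N k)) =
      ((m : ℕ) : ℚ)⁻¹ • ((if k = m then -(q m - source K m) else 0) +
        if (k : ℕ) ∣ (m : ℕ) then ((m : ℕ) / (k : ℕ) : ℚ) • formalSum fun g =>
          X none ^ ((k : ℕ) * g + ((m : ℕ) - (k : ℕ))) *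
            subst q (pderiv K m (psiCh ψ π N k g)) else 0) := by
    intro k _
    have hS : X none ^ ((m : ℕ) - (k : ℕ)) * subst (kappaSubst q) (formalSum fun g =>
        X none ^ ((k : ℕ) * g) * rename (Function.Embedding.inr.trans Function.Embedding.some)
          (pderiv K m (psiCh ψ π N k g))) = formalSum fun g =>
        X none ^ ((k : ℕ) * g + ((m : ℕ) - (k : ℕ))) *
          subst q (pderiv K m (psiCh ψ π N k g)) := by
      rw [subst_formalSum (hfin k _ _) hs]
      simp only [subst_mul hs, subst_pow hs, subst_X hs, subst_rename _ hs, hcomp]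
      rw [show kappaSubst q none = X none from rfl, mul_formalSum (hfin k _ _)]
      simp only [← mul_assoc, ← pow_add, add_comm]
    rw [pderiv_kappa, subst_add hs, subst_smul hs, mul_add, mul_smul_comm, hS]
    have hk : ((k : ℕ) : ℚ) ≠ 0 := by simp
    have hm : ((m : ℕ) : ℚ) ≠ 0 := by simp
    rw [smul_add]
    congr 1
    · split_ifs with h
      · subst h
        rw [← neg_one_smul ℚ, subst_smul hs, subst_smul hs, subst_sub hs, subst_sub hs,
          subst_X hs, subst_X hs, subst_mul hs, subst_pow hs, subst_X hs,
          ← substAlgHom_apply (R := K) hs (eps k : MvPowerSeries _ K), map_natCast, Nat.sub_self,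
          pow_zero, one_mul, source]
        simp only [kappaSubst, Option.elim_some, Option.elim_none, Sum.elim_inl, Sum.elim_inr]
        module
      · rw [← substAlgHom_apply (R := K) hs, map_zero, mul_zero, smul_zero]
    · split_ifs with h
      · rw [smul_smul]
        congr 1
        field_simp
      · have h' : ¬ k ∣ m := fun h' => h (PNat.dvd_iff.mp h')
        simp only [pderiv_psiCh_of_not_dvd ψ π N h', ← substAlgHom_apply (R := K) hq, map_zero,
          mul_zero]
        rw [formalSum_eq_of_forall_ne 0 fun _ _ => rfl, smul_zero, smul_zero]
  rw [Finset.sum_congr rfl hterm, ← Finset.smul_sum, Finset.sum_add_distrib,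
    Finset.sum_ite_eq' , ← Finset.sum_filter, ← subst_interaction ψ π N (by simp) hq,
    smul_eq_zero_iff_right (by simp), if_pos (by simp), neg_add_eq_zero, sub_eq_iff_eq_add']

end StableModule

namespace StableModule

open Finsupp hiding some
open WithPiTopology

/-! ### Coefficients of powers of `ħ` -/

section HbarCoeff

variable {K : Type*} [CommRing K]

theorem coeff_hbarCoeff (s : ℕ) (f : MvPowerSeries (Option ℕ+) K) (d : ℕ+ →₀ ℕ) :
    coeff d (hbarCoeff s f) = coeff (d.optionElim s) f := rfl

theorem hbarCoeff_zero_eq_killCompl (f : MvPowerSeries (Option ℕ+) K) :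
    hbarCoeff 0 f = killCompl Function.Embedding.some f := by
  ext d
  rw [coeff_hbarCoeff, coeff_killCompl]
  congr 2
  ext (_ | i)
  · rw [optionElim_apply_none, embDomain_of_notMem_range _ _ _ (by simp)]
  · rw [optionElim_apply_some]
    exact (embDomain_apply_self Function.Embedding.some d i).symm

theorem hbarCoeff_add (s : ℕ) (f g : MvPowerSeries (Option ℕ+) K) :
    hbarCoeff s (f + g) = hbarCoeff s f + hbarCoeff s g := rfl

theorem hbarCoeff_formalSum (s : ℕ) (F : ℕ → MvPowerSeries (Option ℕ+) K) :
    hbarCoeff s (formalSum F) = formalSum fun g => hbarCoeff s (F g) := rfl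

theorem hbarCoeff_sum {ι : Type*} (t : Finset ι) (s : ℕ) (f : ι → MvPowerSeries (Option ℕ+) K) :
    hbarCoeff s (∑ i ∈ t, f i) = ∑ i ∈ t, hbarCoeff s (f i) := by
  ext d
  simp [coeff_hbarCoeff]

theorem hbarCoeff_X_none_pow_mul (r s : ℕ) (f : MvPowerSeries (Option ℕ+) K) :
    hbarCoeff r (X none ^ s * f) = if s ≤ r then hbarCoeff (r - s) f else 0 := by
  classical
  ext d
  have hiff : single none s ≤ d.optionElim r ↔ s ≤ r := by
    rw [single_le_iff, optionElim_apply_none]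
  rw [coeff_hbarCoeff, X_pow_eq, coeff_monomial_mul, one_mul]
  simp only [hiff]
  split_ifs with h
  · rw [coeff_hbarCoeff]
    congr 2
    ext (_ | i)
    · simp
    · simp
  · rw [map_zero]

theorem hbarCoeff_rename {r : ℕ} (hr : r ≠ 0) (f : MvPowerSeries ℕ+ K) :
    hbarCoeff r (rename Function.Embedding.some f) = 0 := by
  ext d
  by_contra h
  rw [map_zero, coeff_hbarCoeff, ← one_mul (rename _ _), ← pow_zero (X none)] at h
  have := (coeff_X_none_pow_mul_rename h).1
  rw [optionElim_apply_none] at this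
  exact hr this

theorem exists_eq_rename_add {r : ℕ} (hr : r ≠ 0) {f : MvPowerSeries (Option ℕ+) K}
    (hf : f ∈ formSubring K (2 * r)) : ∃ f', f =
      rename Function.Embedding.some (hbarCoeff 0 f) + X none ^ r * f' ∧
        hbarCoeff r f = hbarCoeff 0 f' := by
  have hdvd : X none ^ r ∣ f - rename Function.Embedding.some (hbarCoeff 0 f) := by
    rw [X_pow_dvd_iff]
    intro d hd
    by_cases h0 : d none = 0
    · obtain ⟨x, rfl⟩ : ∃ x, embDomain Function.Embedding.some x = d := by
        refine ⟨d.some, ?_⟩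
        ext (_ | i)
        · rw [embDomain_of_notMem_range _ _ _ (by simp), h0]
        · exact embDomain_apply_self Function.Embedding.some d.some i
      rw [map_sub, coeff_embDomain_rename, hbarCoeff_zero_eq_killCompl, coeff_killCompl, sub_self]
    · rw [map_sub, hf d h0 (by lia), zero_sub, neg_eq_zero]
      by_contra h
      rw [← one_mul (rename _ _), ← pow_zero (X none)] at h
      exact h0 (coeff_X_none_pow_mul_rename h).1
  obtain ⟨f', hf'⟩ := hdvd
  have hfeq := eq_add_of_sub_eq' hf'
  refine ⟨f', hfeq, ?_⟩
  conv_lhs => rw [hfeq]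
  rw [hbarCoeff_add, hbarCoeff_rename hr, hbarCoeff_X_none_pow_mul, if_pos le_rfl, Nat.sub_self,
    zero_add]

theorem hbarCoeff_zero_mul (f g : MvPowerSeries (Option ℕ+) K) :
    hbarCoeff 0 (f * g) = hbarCoeff 0 f * hbarCoeff 0 g := by
  simp only [hbarCoeff_zero_eq_killCompl, map_mul]

/-- Both factors have the form `f₀ + ħ^r f'` with `f₀` free of `ħ`, so the cross term `ħ^{2r} f'g'`
does not reach order `r`. -/
theorem hbarCoeff_mul {r : ℕ} (hr : r ≠ 0) {f g : MvPowerSeries (Option ℕ+) K}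
    (hf : f ∈ formSubring K (2 * r)) (hg : g ∈ formSubring K (2 * r)) :
    hbarCoeff r (f * g) = hbarCoeff r f * hbarCoeff 0 g + hbarCoeff 0 f * hbarCoeff r g := by
  obtain ⟨f', hf', hfr⟩ := exists_eq_rename_add hr hf
  obtain ⟨g', hg', hgr⟩ := exists_eq_rename_add hr hg
  have hprod : f * g = rename Function.Embedding.some (hbarCoeff 0 f * hbarCoeff 0 g) +
      X none ^ r * (f' * rename Function.Embedding.some (hbarCoeff 0 g) +
        rename Function.Embedding.some (hbarCoeff 0 f) * g' + X none ^ r * (f' * g')) := by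
    conv_lhs => rw [hf', hg']
    rw [map_mul]
    ring
  have h0 : ∀ h : MvPowerSeries ℕ+ K, hbarCoeff 0 (rename Function.Embedding.some h) = h :=
    fun h => by rw [hbarCoeff_zero_eq_killCompl, killCompl_rename_app]
  rw [hprod, hbarCoeff_add, hbarCoeff_rename hr, hbarCoeff_X_none_pow_mul, if_pos le_rfl,
    Nat.sub_self, zero_add, hbarCoeff_add, hbarCoeff_add, hbarCoeff_zero_mul, hbarCoeff_zero_mul,
    h0, h0, hbarCoeff_X_none_pow_mul, if_neg (by lia), add_zero, hfr, hgr]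

theorem hbarCoeff_zero_subst {q : ℕ+ → MvPowerSeries (Option ℕ+) K} (hq : HasSubst q)
    (G : MvPowerSeries ℕ+ K) :
    hbarCoeff 0 (subst q G) = subst (fun m => hbarCoeff 0 (q m)) G := by
  simp only [hbarCoeff_zero_eq_killCompl, killCompl_subst _ hq]

theorem hasSubst_hbarCoeff_zero {q : ℕ+ → MvPowerSeries (Option ℕ+) K} (hq : HasSubst q) :
    HasSubst fun m => hbarCoeff 0 (q m) := by
  simp only [hbarCoeff_zero_eq_killCompl]
  exact hq.killCompl _

/-- First order Taylor expansion: if only `q₁` involves `ħ` up to the order `ħ^r`, and does so only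
in the order `ħ^r`, then the coefficient of `ħ^r` in `G(q)` is `(∂G/∂q₁)` times that of `q₁`. -/
theorem hbarCoeff_subst {r : ℕ} (hr : r ≠ 0) {q : ℕ+ → MvPowerSeries (Option ℕ+) K}
    (hq : HasSubst q) (hform : ∀ j, q j ∈ formSubring K (2 * r))
    (hq1 : ∀ j ≠ 1, hbarCoeff r (q j) = 0) (G : MvPowerSeries ℕ+ K) :
    hbarCoeff r (subst q G) =
      subst (fun m => hbarCoeff 0 (q m)) (pderiv K 1 G) * hbarCoeff r (q 1) := by
  let : UniformSpace K := ⊥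
  have hs := hasSubst_hbarCoeff_zero hq
  refine congrFun (eq_of_continuous_of_eq_on_polynomials
    (F := fun G => hbarCoeff r (subst q G))
    (G := fun G => subst (fun m => hbarCoeff 0 (q m)) (pderiv K 1 G) * hbarCoeff r (q 1))
    (continuous_pi fun d => (continuous_coeff K (d.optionElim r)).comp (continuous_subst hq))
    (((continuous_subst hs).comp (continuous_pderiv 1)).mul continuous_const) fun p => ?_) G
  -- The product rule needs the absence of intermediate powers of `ħ`, so this is carried along in
  -- the induction on polynomials.
  suffices h : subst q (p : MvPowerSeries ℕ+ K) ∈ formSubring K (2 * r) ∧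
      hbarCoeff r (subst q (p : MvPowerSeries ℕ+ K)) =
        subst (fun m => hbarCoeff 0 (q m)) (pderiv K 1 (p : MvPowerSeries ℕ+ K)) *
          hbarCoeff r (q 1) from h.2
  have hzero : subst (fun m => hbarCoeff 0 (q m)) (0 : MvPowerSeries ℕ+ K) = 0 := by
    rw [← substAlgHom_apply hs, map_zero]
  induction p using MvPolynomial.induction_on with
  | C a =>
    rw [MvPolynomial.coe_C, pderiv_C, subst_C, hzero, zero_mul,
      ← rename_C Function.Embedding.some, hbarCoeff_rename hr]
    refine ⟨fun d hd _ => ?_, rfl⟩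
    rw [rename_C, coeff_C, if_neg]
    rintro rfl
    exact hd rfl
  | add p p' hp hp' =>
    rw [MvPolynomial.coe_add, subst_add hq, map_add, subst_add hs, add_mul, hbarCoeff_add, hp.2,
      hp'.2]
    exact ⟨add_mem hp.1 hp'.1, rfl⟩
  | mul_X p i hp =>
    rw [MvPolynomial.coe_mul, MvPolynomial.coe_X, subst_mul hq, subst_X hq,
      hbarCoeff_mul hr hp.1 (hform i), hp.2, Derivation.leibniz, subst_add hs, smul_eq_mul,
      smul_eq_mul, subst_mul hs, subst_mul hs, subst_X hs, hbarCoeff_zero_subst hq]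
    refine ⟨mul_mem hp.1 (hform i), ?_⟩
    by_cases hi : i = 1
    · subst hi
      rw [pderiv_X_self, ← substAlgHom_apply hs 1, map_one]
      ring
    · rw [pderiv_X_of_ne hi, hzero, hq1 i hi]
      ring

end HbarCoeff

/-! ### The leading coefficients of the solution -/

section Solution

variable {R K : Type*} [CommRing R] [CommRing K] (ψ : ℕ+ →* (R →+* R)) (π : R →+* K)

theorem subst_map_adams {c : MvPowerSeries ℕ+ R} (hc : c ∈ weightIdeal R PNat.val 1)
    (f : MvPowerSeries ℕ+ R) :
    subst (fun m => map π (adams ψ m c)) (map π f) = map π (plethysm ψ f c) :=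
  (map_subst (hasSubst_adams_of_mem ψ hc) f).symm

theorem hbarCoeff_zero_source (m : ℕ+) : hbarCoeff 0 (source K m) = X m := by
  have h0 : killCompl Function.Embedding.some (X none : MvPowerSeries (Option ℕ+) K) = 0 :=
    killCompl_X_eq_zero (by simp)
  rw [hbarCoeff_zero_eq_killCompl, source, map_add, map_mul, map_pow, h0]
  have hX : killCompl Function.Embedding.some (X (some m) : MvPowerSeries (Option ℕ+) K) = X m :=
    killCompl_X (e := Function.Embedding.some) m
  rw [hX]
  by_cases h : Even (m : ℕ)
  · have := Nat.div_pos (Nat.le_of_dvd m.pos h.two_dvd) two_pos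
    rw [zero_pow this.ne', mul_zero, add_zero]
  · rw [eps_of_odd h, Nat.cast_zero, map_zero, zero_mul, add_zero]

variable [Algebra ℚ R] [Algebra ℚ K] (N : ℕ → (ℕ+ →₀ ℕ) → R)

/-- At `ħ = 0` only exponent `kg + m - k = 0` survives, which forces `k = m` and `g = 0`. -/
theorem subst_extend_zero_interaction {τ : Type*} {q : ℕ+ → MvPowerSeries τ K} (hq : HasSubst q)
    (m : ℕ+) : subst (extend 0 q) (interaction ψ π N m) =
      subst q (map π (adams ψ m (pderiv R 1 (ch N 0)))) := by
  rw [subst_interaction ψ π N (map_zero _) hq, Finset.sum_eq_single m]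
  · have hm : ((m : ℕ) : ℚ) ≠ 0 := by simp
    rw [div_self hm, one_smul, formalSum_eq_of_forall_ne 0]
    · rw [mul_zero, Nat.sub_self, add_zero, pow_zero, one_mul]
      have := pderiv_psiCh ψ π N m 1 0
      rw [mul_one] at this
      rw [this]
    · intro g hg
      rw [zero_pow, zero_mul]
      have := Nat.mul_pos m.pos (Nat.pos_of_ne_zero hg)
      lia
  · intro k hk hne
    have hlt : (k : ℕ) < m :=
      PNat.coe_lt_coe _ _ |>.mpr
        (lt_of_le_of_ne (Finset.mem_Icc.mp (Finset.mem_filter.mp hk).1).2 hne)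
    have h0 : ∀ g, (0 : MvPowerSeries τ K) ^ ((k : ℕ) * g + ((m : ℕ) - (k : ℕ))) *
        subst q (pderiv K m (psiCh ψ π N k g)) = 0 := fun g => by
      rw [zero_pow (by lia), zero_mul]
    rw [formalSum_eq_of_forall_ne 0 fun g _ => h0 g, h0, smul_zero]
  · intro h
    exact absurd (by simp) h

variable {ψ π N} {c : MvPowerSeries ℕ+ R} {q : ℕ+ → MvPowerSeries (Option ℕ+) K}

theorem hbarCoeff_zero_solution (hc : IsPlethysticInverse ψ (c₁ N) c)
    (h : IsFormalSolution ψ π N q) (m : ℕ+) : hbarCoeff 0 (q m) = map π (adams ψ m c) := by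
  obtain ⟨hq, hsol⟩ := (isFormalSolution_iff ψ π N).mp h
  have hc1 := mem_weightIdeal_one_iff.mpr hc.constantCoeff_right
  have hs := (hasSubst_adams_of_mem ψ hc1).map π
  have h1 : SolvesSystem (interaction ψ π N) 0 X fun m => hbarCoeff 0 (q m) := by
    intro m
    rw [← hbarCoeff_zero_source]
    beta_reduce
    conv_lhs => rw [hsol m, hbarCoeff_add]
    rw [hbarCoeff_zero_eq_killCompl (subst _ _), killCompl_subst _ (hasSubst_extend (by simp) hq)]
    congr 2
    funext v
    rcases v with _ | i
    · exact killCompl_X_eq_zero (by simp)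
    · exact (hbarCoeff_zero_eq_killCompl _).symm
  have h2 : SolvesSystem (interaction ψ π N) 0 X fun m => map π (adams ψ m c) := by
    intro m
    rw [subst_extend_zero_interaction ψ π N hs, subst_map_adams ψ π hc1]
    -- Unfolded, the inverse property reads `c = p₁ + (∂ch₀/∂p₁) ∘ c`; applying `ψₘ` gives the
    -- `m`-th equation at `ħ = 0`.
    have hfix : plethysm ψ (c₁ N) c = X 1 := hc.left_comp
    rw [c₁, plethysm, subst_sub (hasSubst_adams_of_mem ψ hc1), ← plethysm, ← plethysm,
      X_one_plethysm ψ hc1] at hfix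
    have hm : adams ψ m c = X m + adams ψ m (plethysm ψ (pderiv R 1 (ch N 0)) c) := by
      have := congrArg (adamsHom ψ m) (eq_add_of_sub_eq hfix)
      rwa [map_add, adamsHom_apply, adamsHom_apply, adamsHom_apply, adams_X, mul_one] at this
    rw [adams_plethysm ψ m hc1] at hm
    beta_reduce
    conv_lhs => rw [hm, map_add, map_X]
    rfl
  exact congrFun (h1.unique h2 (isContracting_interaction ψ π N) (map_zero _) (by simp)
    (hasSubst_hbarCoeff_zero hq) hs) m

/-- The constant term is 1, since `p₁²` is unstable in genus zero and does not occur in `ch₀`. -/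
theorem isUnit_one_sub_adams (m : ℕ+) :
    IsUnit (1 - adams ψ m (pderiv R 1 (pderiv R 1 (ch N 0)))) := by
  have h : constantCoeff (pderiv R 1 (pderiv R 1 (ch N 0))) = 0 := by
    by_contra h
    refine coeff_pderiv_ne_zero h (pderiv_one_ch_mem N _ ?_)
    simp [weight_single]
  have h' : constantCoeff (adams ψ m (pderiv R 1 (pderiv R 1 (ch N 0)))) = 0 := by
    rw [adams, constantCoeff_rename, constantCoeff_map, h, map_zero]
  rw [isUnit_iff_constantCoeff, map_sub, h', map_one, sub_zero]
  exact isUnit_one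

theorem hbarCoeff_solution (hc : IsPlethysticInverse ψ (c₁ N) c)
    (h : IsFormalSolution ψ π N q) (hform : HasForm q) {m r : ℕ+} (hm : m = 2 * r) :
    hbarCoeff r (q m) = map π (plethysm ψ ((1 + 2 * adams ψ r (pderiv R 2 (ch N 0))) *
      Ring.inverse (1 - adams ψ m (pderiv R 1 (pderiv R 1 (ch N 0))))) c) := by
  have hc1 := mem_weightIdeal_one_iff.mpr hc.constantCoeff_right
  have hs := hasSubst_adams_of_mem ψ hc1
  have hq := h.hasSubst
  rw [hasForm_iff] at hform
  have hm' : (m : ℕ) = 2 * r := by rw [hm]; rfl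
  have hrpos : 0 < (r : ℕ) := r.pos
  have hr : (r : ℕ) ≠ 0 := r.ne_zero
  have hzero : (fun m => hbarCoeff 0 (q m)) = fun m => map π (adams ψ m c) :=
    funext fun m => hbarCoeff_zero_solution hc h m
  have hsource : hbarCoeff r (source K m) = 1 := by
    rw [source, hbarCoeff_add, eps_of_even (by rw [hm']; exact even_two_mul _), Nat.cast_one,
      one_mul, hm', Nat.mul_div_cancel_left _ two_pos, ← mul_one (X none ^ (r : ℕ)),
      hbarCoeff_X_none_pow_mul, if_pos le_rfl, Nat.sub_self, hbarCoeff_zero_eq_killCompl, map_one,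
      show (X (some m) : MvPowerSeries (Option ℕ+) K) =
      rename Function.Embedding.some (X m) from (rename_X Function.Embedding.some m).symm,
      hbarCoeff_rename hr, zero_add]
  have hfirst : hbarCoeff r (subst q (pderiv K m (psiCh ψ π N m 0))) =
      map π (plethysm ψ (adams ψ m (pderiv R 1 (pderiv R 1 (ch N 0)))) c) *
        hbarCoeff r (q m) := by
    have hps := pderiv_psiCh ψ π N m 1 0
    rw [mul_one] at hps
    rw [hps, adams, ← rename_map, subst_rename _ hq,
      hbarCoeff_subst hr (hq.comp_embedding _) (fun j => ?_) (fun j hj => ?_)]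
    · congr 1
      · rw [← subst_map_adams ψ π hc1, ← hzero, adams, ← rename_map,
          subst_rename _ (hasSubst_hbarCoeff_zero hq), ← map_pderiv, ← map_pderiv]
        rfl
      · simp
    · refine formSubring_anti ?_ (hform (m * j))
      rw [← hm', PNat.mul_coe]
      exact Nat.le_mul_of_pos_right _ j.pos
    -- For `j > 1` the form of `q_{mj}` excludes order `r`, as `2r = m < mj`; thus only `qₘ` enters
    -- the Taylor expansion.
    · ext d
      refine hform (m * j) _ (by simp) ?_
      rw [optionElim_apply_none, ← hm', PNat.mul_coe]
      have : 1 < (j : ℕ) := lt_of_le_of_ne j.pos fun h => hj (PNat.coe_injective h.symm)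
      nlinarith [m.pos]
  have hsecond : hbarCoeff 0 (subst q (pderiv K m (psiCh ψ π N r 0))) =
      map π (plethysm ψ (adams ψ r (pderiv R 2 (ch N 0))) c) := by
    rw [hm, mul_comm, pderiv_psiCh, hbarCoeff_zero_subst hq, hzero, subst_map_adams ψ π hc1]
  have hcoeff : hbarCoeff r (q m) = 1 +
      (map π (plethysm ψ (adams ψ m (pderiv R 1 (pderiv R 1 (ch N 0)))) c) * hbarCoeff r (q m) +
        2 * map π (plethysm ψ (adams ψ r (pderiv R 2 (ch N 0))) c)) := by
    conv_lhs => rw [h.eqn m, ← source, hbarCoeff_add, hsource, hbarCoeff_sum]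
    have hne : m ≠ r := fun h => by
      have := congrArg PNat.val h
      lia
    have hmQ : ((m : ℕ) : ℚ) ≠ 0 := by simp
    have hrQ : ((r : ℕ) : ℚ) ≠ 0 := by simp
    have hterm : ∀ k : ℕ+, hbarCoeff r (((m : ℕ) / (k : ℕ) : ℚ) • formalSum fun g =>
        X none ^ ((k : ℕ) * g + ((m : ℕ) - (k : ℕ))) *
          subst q (pderiv K m (psiCh ψ π N k g))) = ((m : ℕ) / (k : ℕ) : ℚ) • formalSum fun g =>
        if (k : ℕ) * g + ((m : ℕ) - (k : ℕ)) ≤ r then hbarCoeff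
          (r - ((k : ℕ) * g + ((m : ℕ) - (k : ℕ)))) (subst q (pderiv K m (psiCh ψ π N k g)))
        else 0 := fun k => by
      simp only [← hbarCoeff_X_none_pow_mul, ← hbarCoeff_formalSum]
      rfl
    simp only [hterm]
    rw [Finset.sum_eq_add m r hne]
    · congr 2
      · rw [div_self hmQ, one_smul, formalSum_eq_of_forall_ne 0 fun g hg => if_neg ?_]
        · rw [if_pos (by lia), mul_zero, Nat.sub_self, add_zero, Nat.sub_zero, hfirst]
        · have := Nat.mul_le_mul_left (m : ℕ) (Nat.pos_of_ne_zero hg)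
          lia
      · rw [formalSum_eq_of_forall_ne 0 fun g hg => if_neg ?_]
        · rw [if_pos (by lia), mul_zero, zero_add, show (r : ℕ) - ((m : ℕ) - r) = 0 by lia, hsecond,
            hm', Nat.cast_mul, mul_div_assoc, div_self hrQ, mul_one, Nat.cast_ofNat, two_smul,
            two_mul]
        · have := Nat.mul_le_mul_left (r : ℕ) (Nat.pos_of_ne_zero hg)
          lia
    · rintro k hk ⟨hkm, hkr⟩
      have hkdvd : (k : ℕ) ∣ m := (Finset.mem_filter.mp hk).2
      obtain ⟨j, hj⟩ := hkdvd
      have hkr' : (k : ℕ) ≠ r := fun h => hkr (PNat.coe_injective h)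
      have hkm' : (k : ℕ) ≠ m := fun h => hkm (PNat.coe_injective h)
      -- With `m` and `r = m/2` excluded, the quotient `j = m/k` is at least 3, so `m - k ≥ 2m/3 >
      -- r`.
      have hlt : (r : ℕ) < m - k := by
        rcases j with _ | _ | _ | j
        · lia
        · lia
        · lia
        · have : (k : ℕ) * 3 ≤ k * (j + 1 + 1 + 1) := Nat.mul_le_mul_left _ (by lia)
          have := k.pos
          lia
      have h0 : ∀ g, (if (k : ℕ) * g + ((m : ℕ) - (k : ℕ)) ≤ r then hbarCoeff
          (r - ((k : ℕ) * g + ((m : ℕ) - (k : ℕ)))) (subst q (pderiv K m (psiCh ψ π N k g)))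
          else 0) = 0 := fun g => if_neg (by lia)
      rw [formalSum_eq_of_forall_ne 0 fun g _ => h0 g, h0, smul_zero]
    · intro h
      exact absurd (by simp) h
    · intro h
      refine absurd ?_ h
      rw [Finset.mem_filter, Finset.mem_Icc]
      refine ⟨⟨one_le, ?_⟩, ⟨2, by lia⟩⟩
      rw [← PNat.coe_le_coe]
      lia
  -- As `f ↦ π(f ∘ c)` is a ring homomorphism, the inverse can be taken before the plethysm and the
  -- linear equation solved in its image.
  set φ : MvPowerSeries ℕ+ R →+* MvPowerSeries ℕ+ K :=
    (map π).comp (substAlgHom (R := R) hs).toRingHom with hφ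
  have hφ' : ∀ f, map π (plethysm ψ f c) = φ f := fun f => by simp [hφ, plethysm]
  simp only [hφ'] at hcoeff ⊢
  have hinv := congrArg φ (Ring.mul_inverse_cancel _ (isUnit_one_sub_adams (ψ := ψ) (N := N) m))
  rw [map_mul, map_sub, map_one] at hinv
  rw [map_mul, map_add, map_mul, map_one, map_ofNat]
  linear_combination (-hbarCoeff r (q m)) * hinv +
    φ (Ring.inverse (1 - adams ψ m (pderiv R 1 (pderiv R 1 (ch N 0))))) * hcoeff

end Solution

end StableModule

theorem mainTheorem3 {R K : Type*} [CommRing R] [Algebra ℚ R] [CommRing K] [Algebra ℚ K]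
    (ψ : ℕ+ →* (R →+* R)) (π : R →+* K) (N : ℕ → (ℕ+ →₀ ℕ) → R) :
    -- `c₁` has a unique plethystic inverse
    (∃! cbar : MvPowerSeries ℕ+ R, IsPlethysticInverse ψ (c₁ N) cbar) ∧
    -- the explicit system is the critical point system of `𝒦`
    (∀ qbar : ℕ+ → MvPowerSeries (Option ℕ+) K, HasSubst qbar →
      (IsCriticalPoint ψ π N qbar ↔ IsFormalSolution ψ π N qbar)) ∧
    -- there is a unique solution of the asserted form
    (∃! qbar : ℕ+ → MvPowerSeries (Option ℕ+) K, IsFormalSolution ψ π N qbar ∧ HasForm qbar) ∧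
    -- the coefficients of this solution
    (∀ (cbar : MvPowerSeries ℕ+ R) (qbar : ℕ+ → MvPowerSeries (Option ℕ+) K),
      IsPlethysticInverse ψ (c₁ N) cbar → IsFormalSolution ψ π N qbar → HasForm qbar →
      (∀ m : ℕ+, hbarCoeff 0 (qbar m) = map π (adams ψ m cbar)) ∧
      (∀ m r : ℕ+, m = 2 * r →
        IsUnit (1 - adams ψ m (pderiv R 1 (pderiv R 1 (ch N 0)))) ∧
        hbarCoeff r (qbar m) = map π (plethysm ψ
          ((1 + 2 * adams ψ r (pderiv R 2 (ch N 0))) *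
            Ring.inverse (1 - adams ψ m (pderiv R 1 (pderiv R 1 (ch N 0))))) cbar))) :=
  ⟨existsUnique_isPlethysticInverse ψ (pderiv_one_ch_mem N),
    fun _ hq => isCriticalPoint_iff ψ π N hq, existsUnique_isFormalSolution ψ π N,
    fun _ _ hc h hform => ⟨hbarCoeff_zero_solution hc h,
      fun m _ hm => ⟨isUnit_one_sub_adams m, hbarCoeff_solution hc h hform hm⟩⟩⟩
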